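/- Let $k$ be a commutative ring in which $2$ is invertible, let $J$ be a finite set with an involution $c\colon J\to J$ (so $c^2=\mathrm{id}$; fixed points are allowed), and let $n\ge 0$. Let $\widetilde Q_{i,j}(u,v)\in k[u,v]$ $(i,j\in J)$ be polynomials such that, for all $i,j\in J$, $$\widetilde Q_{j,i}(u,v)=\widetilde Q_{i,j}(v,u),\qquad \widetilde Q_{c(i),j}(-u,v)=\widetilde Q_{i,c(j)}(u,-v)=\widetilde Q_{i,j}(u,v),\qquad \widetilde Q_{i,j}=0\ \text{ if } j\in\{i,c(i)\}.$$ For $\nu=(\nu_1,\dots,\nu_n)\in J^n$ let $c_p\nu$ be $\nu$ with $\nu_p$ replaced by $c(\nu_p)$, and let $s_a\nu$ be $\nu$ with $\nu_a$ and $\nu_{a+1}$ exchanged, where $s_a=(a,a+1)\in S_n$. The quiver Hecke–Clifford superalgebra $RC_n$ is the $k$-superalgebra generated by the even elements $y_p$ $(1\le p\le n)$, $\sigma_a$ $(1\le a<n)$, $e(\nu)$ $(\nu\in J^n)$ and the odd elements $c_p$ $(1\le p\le n)$, with the following defining relations, for all admissible $\mu,\nu,p,q,a,b$: 1. $e(\mu)e(\nu)=\delta_{\mu\nu}e(\mu)$,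 $\ 1=\sum_{\nu\in J^n}e(\nu)$, $\ y_pe(\nu)=e(\nu)y_p$, $\ c_pe(\nu)=e(c_p\nu)c_p$; 2. $y_py_q=y_qy_p$, $\ c_pc_q+c_qc_p=2\delta_{pq}$, $\ c_py_q=(-1)^{\delta_{pq}}y_qc_p$; 3. $\sigma_ae(\nu)=e(s_a\nu)\sigma_a$, $\ \sigma_ac_p=c_{s_a(p)}\sigma_a$, and $\sigma_ay_pe(\nu)=y_p\sigma_ae(\nu)$ if $p\ne a,a+1$; 4. $(\sigma_ay_{a+1}-y_a\sigma_a)e(\nu)=\delta_{\nu_a,\nu_{a+1}}e(\nu)-\delta_{\nu_a,c(\nu_{a+1})}c_ac_{a+1}e(\nu)$; 5. $(y_{a+1}\sigma_a-\sigma_ay_a)e(\nu)=\delta_{\nu_a,\nu_{a+1}}e(\nu)+\delta_{\nu_a,c(\nu_{a+1})}c_ac_{a+1}e(\nu)$; 6. $\sigma_a^2e(\nu)=\widetilde Q_{\nu_a,\nu_{a+1}}(y_a,y_{a+1})e(\nu)$; 7. $\sigma_a\sigma_b=\sigma_b\sigma_a$ if $|a-b|>1$; 8. for $1\le a\le n-2$,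 $$(\sigma_{a+1}\sigma_a\sigma_{a+1}-\sigma_a\sigma_{a+1}\sigma_a)e(\nu)=\delta_{\nu_a,\nu_{a+2}}\frac{\widetilde Q_{\nu_a,\nu_{a+1}}(y_{a+2},y_{a+1})-\widetilde Q_{\nu_a,\nu_{a+1}}(y_a,y_{a+1})}{y_{a+2}-y_a}e(\nu)$$ $$\qquad+\ \delta_{\nu_a,c(\nu_{a+2})}\frac{\widetilde Q_{\nu_a,\nu_{a+1}}(y_{a+2},y_{a+1})-\widetilde Q_{\nu_a,\nu_{a+1}}(-y_a,y_{a+1})}{y_{a+2}+y_a}c_ac_{a+2}e(\nu),$$ where the quotients are taken in the polynomial ring $k[y_1,\dots,y_n]$. For each $w\in S_n$ choose a reduced expression $w=s_{i_1}\cdots s_{i_\ell}$ and set $\sigma_w=\sigma_{i_1}\cdots\sigma_{i_\ell}$. For $a\in\mathbb Z_{\ge0}^n$ and $\eta\in(\mathbb Z/2)^n$ put $y^a=y_1^{a_1}\cdots y_n^{a_n}$ and $c^\eta=c_1^{\eta_1}\cdots c_n^{\eta_n}$ (with $\eta_p\in\{0,1\}$). Then the elements $$y^a\,c^\eta\,\sigma_w\,e(\nu)\qquad(a\in\mathbb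 Z_{\ge0}^n,\ \eta\in(\mathbb Z/2)^n,\ w\in S_n,\ \nu\in J^n)$$ form a $k$-basis of $RC_n$. -/

import Mathlib

namespace QHC

/-- The conditions on an involution `c` of `J` and a family `Q i j ∈ k[u, v]`
(`u = X 0`, `v = X 1`) from which a quiver Hecke-Clifford superalgebra is built.
The elements `i` and `j` have the same class in `J / ∼` iff `i = j` or `i = c j`. -/
structure IsDatum {k J : Type*} [CommRing k] (c : J → J)
    (Q : J → J → MvPolynomial (Fin 2) k) : Prop where
  involutive : Function.Involutive c
  symm : ∀ i j, Q j i = MvPolynomial.aeval ![MvPolynomial.X 1, MvPolynomial.X 0] (Q i j)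
  neg_left : ∀ i j,
    MvPolynomial.aeval ![-MvPolynomial.X 0, MvPolynomial.X 1] (Q (c i) j) = Q i j
  neg_right : ∀ i j,
    MvPolynomial.aeval ![MvPolynomial.X 0, -MvPolynomial.X 1] (Q i (c j)) = Q i j
  eq_zero : ∀ i j, (i = j ∨ i = c j) → Q i j = 0

/-- The divided difference `(P(u, v) - P(w, v)) / (u - w)`, by the formula
`(u ^ m - w ^ m) / (u - w) = ∑ s < m, u ^ s * w ^ (m - 1 - s)` on each monomial of `P`. -/
noncomputable def divDiff {k A : Type*} [CommRing k] [CommRing A] [Algebra k A]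
    (P : MvPolynomial (Fin 2) k) (u w v : A) : A :=
  ∑ m ∈ P.support,
    P.coeff m • ((∑ s ∈ Finset.range (m 0), u ^ s * w ^ (m 0 - 1 - s)) * v ^ m 1)

/-- `divDiff P u w v` is a quotient of `P(u, v) - P(w, v)` by `u - w`. -/
theorem divDiff_mul {k A : Type*} [CommRing k] [CommRing A] [Algebra k A]
    (P : MvPolynomial (Fin 2) k) (u w v : A) :
    divDiff P u w v * (u - w) =
      MvPolynomial.aeval ![u, v] P - MvPolynomial.aeval ![w, v] P := by
  rw [divDiff, Finset.sum_mul, MvPolynomial.aeval_def, MvPolynomial.aeval_def,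
    MvPolynomial.eval₂_eq', MvPolynomial.eval₂_eq', ← Finset.sum_sub_distrib]
  refine Finset.sum_congr rfl fun m _ => ?_
  have h := (Commute.all u w).geom_sum₂_mul (m 0)
  simp only [Fin.prod_univ_two, Algebra.smul_def, Matrix.cons_val_zero, Matrix.cons_val_one]
  linear_combination (algebraMap k A (MvPolynomial.coeff m P) * v ^ m 1) * h

/-- The position `a` (of the pair `a, a + 1` exchanged by the simple transposition `s_a`);
positions and simple transpositions are numbered from `0`. -/
def lo {n : ℕ} (a : Fin (n - 1)) : Fin n := ⟨a, by omega⟩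

/-- The position `a + 1`. -/
def hi {n : ℕ} (a : Fin (n - 1)) : Fin n := ⟨a + 1, by omega⟩

/-- The simple transposition `s_a = (a, a + 1)` of the symmetric group. -/
def simpleTransp {n : ℕ} (a : Fin (n - 1)) : Equiv.Perm (Fin n) := Equiv.swap (lo a) (hi a)

/-- The product `s_{i_1} ⋯ s_{i_l}` of a word in the simple transpositions. -/
def wordProd {n : ℕ} (l : List (Fin (n - 1))) : Equiv.Perm (Fin n) :=
  (l.map simpleTransp).prod

/-- `l` is a reduced expression of `w`: a word with product `w`, of minimal length. -/
def IsReducedExpr {n : ℕ} (w : Equiv.Perm (Fin n)) (l : List (Fin (n - 1))) : Prop :=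
  wordProd l = w ∧ ∀ l' : List (Fin (n - 1)), wordProd l' = w → l.length ≤ l'.length

/-- The generators `y_p`, `c_p`, `σ_a`, `e(ν)`. -/
inductive Gen (n : ℕ) (J : Type*)
  | y (p : Fin n)
  | c (p : Fin n)
  | s (a : Fin (n - 1))
  | e (ν : Fin n → J)

section Free

variable (k : Type*) [CommRing k] {n : ℕ} {J : Type*}

/-- The generators in the free algebra. -/
def fy (J : Type*) (p : Fin n) : FreeAlgebra k (Gen n J) := FreeAlgebra.ι k (Gen.y p)

def fc (J : Type*) (p : Fin n) : FreeAlgebra k (Gen n J) := FreeAlgebra.ι k (Gen.c p)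

def fs (J : Type*) (a : Fin (n - 1)) : FreeAlgebra k (Gen n J) := FreeAlgebra.ι k (Gen.s a)

def fe (ν : Fin n → J) : FreeAlgebra k (Gen n J) := FreeAlgebra.ι k (Gen.e ν)

variable {k}

/-- The polynomial `P(y_1, …, y_n)` in the free algebra, each monomial being written in the order
`y_1^{m_1} ⋯ y_n^{m_n}` (the order is irrelevant in the quotient, where the `y_p` commute). -/
noncomputable def fpoly (J : Type*) (P : MvPolynomial (Fin n) k) : FreeAlgebra k (Gen n J) :=
  ∑ m ∈ P.support, P.coeff m • (List.ofFn fun p => fy k J p ^ m p).prod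

open MvPolynomial in
/-- The defining relations. -/
inductive Rel [Fintype J] [DecidableEq J] (c : J → J) (Q : J → J → MvPolynomial (Fin 2) k) :
    FreeAlgebra k (Gen n J) → FreeAlgebra k (Gen n J) → Prop
  | e_mul_e (μ ν : Fin n → J) : Rel c Q (fe k μ * fe k ν) (if μ = ν then fe k μ else 0)
  | one : Rel c Q 1 (∑ ν : Fin n → J, fe k ν)
  | y_mul_e (p : Fin n) (ν : Fin n → J) : Rel c Q (fy k J p * fe k ν) (fe k ν * fy k J p)
  | c_mul_e (p : Fin n) (ν : Fin n → J) :
      Rel c Q (fc k J p * fe k ν) (fe k (Function.update ν p (c (ν p))) * fc k J p)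
  | y_mul_y (p q : Fin n) : Rel c Q (fy k J p * fy k J q) (fy k J q * fy k J p)
  | c_mul_c (p q : Fin n) :
      Rel c Q (fc k J p * fc k J q + fc k J q * fc k J p) (if p = q then 2 else 0)
  | c_mul_y (p q : Fin n) :
      Rel c Q (fc k J p * fy k J q) ((if p = q then -1 else 1) * (fy k J q * fc k J p))
  | s_mul_e (a : Fin (n - 1)) (ν : Fin n → J) :
      Rel c Q (fs k J a * fe k ν) (fe k (ν ∘ simpleTransp a) * fs k J a)
  | s_mul_c (a : Fin (n - 1)) (p : Fin n) :
      Rel c Q (fs k J a * fc k J p) (fc k J (simpleTransp a p) * fs k J a)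
  | s_mul_y (a : Fin (n - 1)) (p : Fin n) (ν : Fin n → J) (_ : p ≠ lo a) (_ : p ≠ hi a) :
      Rel c Q (fs k J a * fy k J p * fe k ν) (fy k J p * fs k J a * fe k ν)
  | s_mul_y_hi (a : Fin (n - 1)) (ν : Fin n → J) :
      Rel c Q ((fs k J a * fy k J (hi a) - fy k J (lo a) * fs k J a) * fe k ν)
        ((if ν (lo a) = ν (hi a) then fe k ν else 0)
          - (if ν (lo a) = c (ν (hi a)) then fc k J (lo a) * fc k J (hi a) * fe k ν else 0))
  | y_hi_mul_s (a : Fin (n - 1)) (ν : Fin n → J) :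
      Rel c Q ((fy k J (hi a) * fs k J a - fs k J a * fy k J (lo a)) * fe k ν)
        ((if ν (lo a) = ν (hi a) then fe k ν else 0)
          + (if ν (lo a) = c (ν (hi a)) then fc k J (lo a) * fc k J (hi a) * fe k ν else 0))
  | s_mul_s (a : Fin (n - 1)) (ν : Fin n → J) :
      Rel c Q (fs k J a * fs k J a * fe k ν)
        (fpoly J (aeval ![X (lo a), X (hi a)] (Q (ν (lo a)) (ν (hi a)))) * fe k ν)
  | s_comm (a b : Fin (n - 1)) (_ : (a : ℕ) + 1 < b) :
      Rel c Q (fs k J a * fs k J b) (fs k J b * fs k J a)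
  -- below `lo a`, `hi a = lo b`, `hi b` are the positions `a`, `a + 1`, `a + 2`
  | braid (a b : Fin (n - 1)) (_ : (b : ℕ) = a + 1) (ν : Fin n → J) :
      Rel c Q
        ((fs k J b * fs k J a * fs k J b - fs k J a * fs k J b * fs k J a) * fe k ν)
        ((if ν (lo a) = ν (hi b) then
            fpoly J (divDiff (Q (ν (lo a)) (ν (hi a))) (X (hi b)) (X (lo a)) (X (hi a)))
              * fe k ν
          else 0)
        + (if ν (lo a) = c (ν (hi b)) then
            fpoly J (divDiff (Q (ν (lo a)) (ν (hi a))) (X (hi b)) (-X (lo a)) (X (hi a)))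
              * (fc k J (lo a) * fc k J (hi b)) * fe k ν
          else 0))

end Free

section Alg

variable {k : Type*} [CommRing k] (n : ℕ) {J : Type*} [Fintype J] [DecidableEq J]
  (c : J → J) (Q : J → J → MvPolynomial (Fin 2) k)

/-- The quiver Hecke-Clifford superalgebra `RC_n` attached to `c` and `Q`
(as a `k`-algebra; its `ℤ/2`-grading is `RC.parityPart`). -/
def RC : Type _ := RingQuot (Rel (n := n) c Q)

noncomputable instance : Ring (RC n c Q) := inferInstanceAs (Ring (RingQuot (Rel (n := n) c Q)))

noncomputable instance : Algebra k (RC n c Q) :=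
  inferInstanceAs (Algebra k (RingQuot (Rel (n := n) c Q)))

variable {n}

/-- The quotient map from the free algebra. -/
noncomputable def RC.mk : FreeAlgebra k (Gen n J) →ₐ[k] RC n c Q := RingQuot.mkAlgHom k (Rel c Q)

theorem RC.mk_rel {x z : FreeAlgebra k (Gen n J)} (h : Rel c Q x z) :
    RC.mk c Q x = RC.mk c Q z := RingQuot.mkAlgHom_rel k h

/-- The generators of `RC_n`. -/
noncomputable def RC.gen (g : Gen n J) : RC n c Q := RC.mk c Q (FreeAlgebra.ι k g)

noncomputable def RC.genY (p : Fin n) : RC n c Q := RC.gen c Q (Gen.y p)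

noncomputable def RC.genC (p : Fin n) : RC n c Q := RC.gen c Q (Gen.c p)

noncomputable def RC.genS (a : Fin (n - 1)) : RC n c Q := RC.gen c Q (Gen.s a)

noncomputable def RC.genE (ν : Fin n → J) : RC n c Q := RC.gen c Q (Gen.e ν)

/-- The monomial `y_1^{a_1} ⋯ y_n^{a_n}`. -/
noncomputable def RC.yPow (a : Fin n → ℕ) : RC n c Q := (List.ofFn fun p => RC.genY c Q p ^ a p).prod

/-- The Clifford monomial `c_1^{η_1} ⋯ c_n^{η_n}`, `η_p ∈ {0, 1}`. -/
noncomputable def RC.cPow (η : Fin n → ZMod 2) : RC n c Q :=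
  (List.ofFn fun p => RC.genC c Q p ^ (η p).val).prod

/-- The product `σ_{i_1} ⋯ σ_{i_l}` along a word. -/
noncomputable def RC.sWord (l : List (Fin (n - 1))) : RC n c Q := (l.map (RC.genS c Q)).prod

/-- The sign of a generator: `-1` for the odd generators `c_p`, `1` for the even ones. -/
def Gen.sign : Gen n J → ℤ
  | .c _ => -1
  | _ => 1

/-- The endomorphism of the free algebra giving each generator its sign. -/
def freeInvol (k : Type*) [CommRing k] (n : ℕ) (J : Type*) :
    FreeAlgebra k (Gen n J) →ₐ[k] FreeAlgebra k (Gen n J) :=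
  FreeAlgebra.lift k fun g => g.sign • FreeAlgebra.ι k g

theorem freeInvol_y {k : Type*} [CommRing k] {n : ℕ} {J : Type*} (p : Fin n) :
    freeInvol k n J (fy k J p) = fy k J p := by
  simp [freeInvol, fy, Gen.sign]

theorem freeInvol_c {k : Type*} [CommRing k] {n : ℕ} {J : Type*} (p : Fin n) :
    freeInvol k n J (fc k J p) = -fc k J p := by
  simp [freeInvol, fc, Gen.sign]

theorem freeInvol_s {k : Type*} [CommRing k] {n : ℕ} {J : Type*} (a : Fin (n - 1)) :
    freeInvol k n J (fs k J a) = fs k J a := by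
  simp [freeInvol, fs, Gen.sign]

theorem freeInvol_e {k : Type*} [CommRing k] {n : ℕ} {J : Type*} (ν : Fin n → J) :
    freeInvol k n J (fe k ν) = fe k ν := by
  simp [freeInvol, fe, Gen.sign]

theorem freeInvol_poly {k : Type*} [CommRing k] {n : ℕ} {J : Type*}
    (P : MvPolynomial (Fin n) k) : freeInvol k n J (fpoly J P) = fpoly J P := by
  simp [fpoly, map_list_prod, List.map_ofFn, Function.comp_def, freeInvol_y]

theorem freeInvol_rel ⦃x z : FreeAlgebra k (Gen n J)⦄ (h : Rel c Q x z) :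
    RC.mk c Q (freeInvol k n J x) = RC.mk c Q (freeInvol k n J z) := by
  have key := RC.mk_rel c Q h
  have h2 : freeInvol k n J 2 = 2 := map_ofNat _ 2
  suffices h : freeInvol k n J x = x ∧ freeInvol k n J z = z ∨
      freeInvol k n J x = -x ∧ freeInvol k n J z = -z by
    rcases h with ⟨h1, h2⟩ | ⟨h1, h2⟩ <;> rw [h1, h2]
    · exact key
    · rw [map_neg, map_neg, key]
  cases h <;>
    first
    | (left
       simp only [map_mul, map_add, map_sub, map_zero, map_one, map_sum, freeInvol_y, freeInvol_c,
         freeInvol_s, freeInvol_e, freeInvol_poly, apply_ite (freeInvol k n J), h2, neg_mul,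
         mul_neg, neg_neg, and_self]
       done)
    | (right
       simp only [map_mul, map_neg, map_one, freeInvol_y, freeInvol_c,
         freeInvol_s, freeInvol_e, apply_ite (freeInvol k n J), neg_mul,
         mul_neg, and_self])

/-- The parity automorphism of `RC_n`: `c_p ↦ -c_p`, and the even generators are fixed. -/
noncomputable def RC.invol : RC n c Q →ₐ[k] RC n c Q :=
  RingQuot.liftAlgHom k ⟨(RC.mk c Q).comp (freeInvol k n J),
    fun _ _ h => freeInvol_rel c Q h⟩

theorem RC.invol_mk (x : FreeAlgebra k (Gen n J)) :
    RC.invol c Q (RC.mk c Q x) = RC.mk c Q (freeInvol k n J x) :=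
  RingQuot.liftAlgHom_mkAlgHom_apply _ _ _ _

theorem RC.invol_gen (g : Gen n J) : RC.invol c Q (RC.gen c Q g) = g.sign • RC.gen c Q g := by
  simp [RC.gen, RC.invol_mk, freeInvol]

theorem RC.invol_invol (x : RC n c Q) : RC.invol c Q (RC.invol c Q x) = x := by
  have h : (RC.invol c Q).comp (RC.invol c Q) = AlgHom.id k (RC n c Q) := by
    apply RingQuot.ringQuot_ext'
    refine FreeAlgebra.hom_ext (funext fun g => ?_)
    change RC.invol c Q (RC.invol c Q (RC.gen c Q g)) = RC.gen c Q g
    rw [RC.invol_gen, map_zsmul, RC.invol_gen]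
    cases g <;> simp [Gen.sign]
  exact DFunLike.congr_fun h x

/-- The `ℤ/2`-grading of `RC_n` in which `y_p`, `σ_a`, `e(ν)` are even and `c_p` is odd. As `2` is
invertible, the part of parity `i` is the eigenspace of the parity automorphism for `(-1)^i`. -/
noncomputable def RC.parityPart (i : ZMod 2) : Submodule k (RC n c Q) :=
  LinearMap.ker ((RC.invol c Q).toLinearMap - (-1 : k) ^ i.val • LinearMap.id)

theorem RC.mem_parityPart {i : ZMod 2} {x : RC n c Q} :
    x ∈ RC.parityPart c Q i ↔ RC.invol c Q x = (-1 : k) ^ i.val • x := by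
  simp [RC.parityPart, sub_eq_zero]

theorem RC.mem_parityPart_zero {x : RC n c Q} :
    x ∈ RC.parityPart c Q 0 ↔ RC.invol c Q x = x := by
  simp [RC.mem_parityPart]

theorem RC.mem_parityPart_one {x : RC n c Q} :
    x ∈ RC.parityPart c Q 1 ↔ RC.invol c Q x = -x := by
  simp [RC.mem_parityPart, ZMod.val_one]

/-- The even part `(x + x') / 2` of `x`, `x'` being its image under the parity automorphism. -/
noncomputable def RC.evenProj [Invertible (2 : k)] : RC n c Q →ₗ[k] RC.parityPart (n := n) c Q 0 :=
  LinearMap.codRestrict _ ((⅟2 : k) • (LinearMap.id + (RC.invol c Q).toLinearMap)) fun x => by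
    rw [RC.mem_parityPart_zero]
    simp [RC.invol_invol, add_comm]

/-- The odd part `(x - x') / 2` of `x`, `x'` being its image under the parity automorphism. -/
noncomputable def RC.oddProj [Invertible (2 : k)] : RC n c Q →ₗ[k] RC.parityPart (n := n) c Q 1 :=
  LinearMap.codRestrict _ ((⅟2 : k) • (LinearMap.id - (RC.invol c Q).toLinearMap)) fun x => by
    rw [RC.mem_parityPart_one]
    simp [RC.invol_invol, ← smul_neg]

theorem RC.coe_evenProj [Invertible (2 : k)] (x : RC n c Q) :
    (RC.evenProj c Q x : RC n c Q) = (⅟2 : k) • (x + RC.invol c Q x) := rfl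

theorem RC.coe_oddProj [Invertible (2 : k)] (x : RC n c Q) :
    (RC.oddProj c Q x : RC n c Q) = (⅟2 : k) • (x - RC.invol c Q x) := rfl

theorem RC.half_add_self [Invertible (2 : k)] (x : RC n c Q) : (⅟2 : k) • (x + x) = x := by
  rw [← two_smul k x, smul_smul, invOf_mul_self, one_smul]

noncomputable instance [Invertible (2 : k)] :
    DirectSum.Decomposition (RC.parityPart (n := n) c Q) :=
  DirectSum.Decomposition.ofLinearMap _
    (DirectSum.lof k (ZMod 2) (fun i => RC.parityPart c Q i) 0 ∘ₗ RC.evenProj c Q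
      + DirectSum.lof k (ZMod 2) (fun i => RC.parityPart c Q i) 1 ∘ₗ RC.oddProj c Q)
    (by
      refine LinearMap.ext fun x => ?_
      simp only [LinearMap.comp_apply, LinearMap.add_apply, map_add,
        DirectSum.coeLinearMap_lof, LinearMap.id_apply]
      rw [RC.coe_evenProj, RC.coe_oddProj, ← smul_add, add_add_sub_cancel, RC.half_add_self])
    (by
      refine DirectSum.linearMap_ext k fun i => LinearMap.ext fun ⟨x, hx⟩ => ?_
      simp only [LinearMap.comp_apply, LinearMap.add_apply, DirectSum.coeLinearMap_lof,
        LinearMap.id_apply]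
      obtain rfl | rfl : i = 0 ∨ i = 1 := (by decide : ∀ i : ZMod 2, i = 0 ∨ i = 1) i
      · have h := (RC.mem_parityPart_zero c Q).1 hx
        have e0 : RC.evenProj c Q x = ⟨x, hx⟩ :=
          Subtype.ext (by rw [RC.coe_evenProj, h, RC.half_add_self])
        have e1 : RC.oddProj c Q x = 0 :=
          Subtype.ext (by rw [RC.coe_oddProj, h, sub_self, smul_zero]; rfl)
        rw [e0, e1, map_zero, add_zero]
      · have h := (RC.mem_parityPart_one c Q).1 hx
        have e0 : RC.evenProj c Q x = 0 :=
          Subtype.ext (by rw [RC.coe_evenProj, h, add_neg_cancel, smul_zero]; rfl)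
        have e1 : RC.oddProj c Q x = ⟨x, hx⟩ :=
          Subtype.ext (by rw [RC.coe_oddProj, h, sub_neg_eq_add, RC.half_add_self])
        rw [e0, e1, map_zero, zero_add])

/-- `RC_n` is a superalgebra, i.e. a `ℤ/2`-graded algebra. -/
noncomputable instance [Invertible (2 : k)] :
    GradedAlgebra (RC.parityPart (n := n) c Q) where
  one_mem := by simp [RC.mem_parityPart]
  mul_mem := by
    intro i j x z hx hz
    rw [RC.mem_parityPart] at *
    rw [map_mul, hx, hz, smul_mul_smul_comm, ← pow_add]
    congr 1
    rw [ZMod.val_add, ← neg_one_pow_eq_pow_mod_two]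

end Alg

end QHC

/-! Spanning is a straightening argument. Let B be `baseAlg`, the subalgebra generated by the `y_p`,
`c_p`, `e(ν)`. The relations give `σ_a B ⊆ B σ_a + B`, and both `σ_a²` and the defect of the braid
relation lie in B. Hence, modulo words with fewer letters `σ`, two reduced words of the same
permutation agree (`sWord_sub_mem_filt`) and a non-reduced word vanishes
(`sWord_mem_filt_of_not_reduced`). Since B is spanned by the `y^a c^η e(ν)` and `e(ν)` can be moved
to the right, the proposed elements span.

Independence comes from a principal series representation. Let K be the total ring of fractions of
`k[y_1, …, y_n]`, in which all `y_i ± y_j` with `i ≠ j` are invertible. The algebra acts on K-valued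
functions of triples (w, signs, colours): slot `i` has an eigenvalue `± y_i` and a colour, changed
by `c` when the sign is negative, and it sits at position `w(i)`. The `y_p` and `e(ν)` are diagonal,
and `c_p` flips the slot at position `p`.

The operator of `σ_a` is a sum `r_{a,a+1} + φ_a`. Here `r_{ij}` (`rOp`) is `(y_j - y_i)⁻¹` where the
colours at `i`, `j` agree, plus `(y_i + y_j)⁻¹ c_i c_j` where they are exchanged by `c`. It is
antisymmetric and solves the classical Yang-Baxter equation. The intertwiner `φ_a` (`twistOp`)
exchanges the positions exactly, satisfies the braid relation, and has square `Q - r²`. The cross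
terms in `(r + φ_a)²` cancel, so `σ_a² = Q`. The Yang-Baxter equation leaves `(Q_{a+1,a+2} -
Q_{a,a+1}) r_{a,a+2}` as the braid defect (`sigmaOp_braid`), and this is the divided difference in
the defining relation.

The square `Q - r²` is distributed unevenly: `φ_a` has coefficient `1` when it lengthens the
permutation and `Q - r²` when it shortens it. So nothing has to be inverted, and `σ_w` applied to
the delta function at the identity has leading term exactly the delta function at `w`
(`rep_sWord_app_deltaFun`). Given a linear relation, one picks a term with `w` of maximal length and
evaluates at one point. What remains is a polynomial in the algebraically independent `± y_i`, so
its coefficients vanish. -/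

namespace QHC

/-! ### Inversions and the length function of the symmetric group. -/

section Inversions

variable {n : ℕ}

theorem lo_lt_hi (a : Fin (n - 1)) : lo a < hi a := by
  simp [lo, hi, Fin.lt_def]

theorem lo_ne_hi (a : Fin (n - 1)) : lo a ≠ hi a := (lo_lt_hi a).ne

@[simp] theorem simpleTransp_lo (a : Fin (n - 1)) : simpleTransp a (lo a) = hi a := by
  simp [simpleTransp]

@[simp] theorem simpleTransp_hi (a : Fin (n - 1)) : simpleTransp a (hi a) = lo a := by
  simp [simpleTransp]

theorem simpleTransp_of_ne (a : Fin (n - 1)) {p : Fin n} (h : p ≠ lo a) (h' : p ≠ hi a) :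
    simpleTransp a p = p := Equiv.swap_apply_of_ne_of_ne h h'

@[simp] theorem simpleTransp_mul_self (a : Fin (n - 1)) :
    simpleTransp a * simpleTransp a = 1 := Equiv.swap_mul_self _ _

@[simp] theorem simpleTransp_mul_self_mul (a : Fin (n - 1)) (w : Equiv.Perm (Fin n)) :
    simpleTransp a * (simpleTransp a * w) = w := by
  rw [← mul_assoc, simpleTransp_mul_self, one_mul]

@[simp] theorem simpleTransp_apply_self (a : Fin (n - 1)) (p : Fin n) :
    simpleTransp a (simpleTransp a p) = p := Equiv.swap_apply_self _ _ _

@[simp] theorem wordProd_nil : wordProd ([] : List (Fin (n - 1))) = 1 := rfl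

@[simp] theorem wordProd_cons (a : Fin (n - 1)) (l : List (Fin (n - 1))) :
    wordProd (a :: l) = simpleTransp a * wordProd l := by
  simp [wordProd]

theorem inv_simpleTransp_mul_apply (a : Fin (n - 1)) (w : Equiv.Perm (Fin n)) (p : Fin n) :
    (simpleTransp a * w)⁻¹ p = w⁻¹ (simpleTransp a p) := by
  rw [mul_inv_rev, simpleTransp, Equiv.swap_inv]
  rfl

/-- The pairs of positions whose order is reversed by `w⁻¹`. -/
def inversions (w : Equiv.Perm (Fin n)) : Finset (Fin n × Fin n) :=
  Finset.univ.filter fun p => p.1 < p.2 ∧ w⁻¹ p.2 < w⁻¹ p.1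

/-- The number of inversions. -/
def invCount (w : Equiv.Perm (Fin n)) : ℕ := (inversions w).card

theorem simpleTransp_lt (a : Fin (n - 1)) {i j : Fin n} (h : i < j)
    (h' : ¬ (i = lo a ∧ j = hi a)) : simpleTransp a i < simpleTransp a j := by
  simp only [simpleTransp, Equiv.swap_apply_def]
  simp only [lo, hi, Fin.ext_iff, Fin.lt_def] at *
  split_ifs <;> simp_all <;> omega

/-- Applying `s_a` to both members of a pair matches the inversions of `w` with those of `s_a w`
other than `(lo a, hi a)`, because that is the only pair of positions whose order `s_a` reverses. -/
theorem invCount_mul_of_lt (a : Fin (n - 1)) (w : Equiv.Perm (Fin n))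
    (h : w⁻¹ (lo a) < w⁻¹ (hi a)) : invCount (simpleTransp a * w) = invCount w + 1 := by
  have hmem : (lo a, hi a) ∈ inversions (simpleTransp a * w) := by
    simpa [inversions, inv_simpleTransp_mul_apply, lo_lt_hi, -mul_inv_rev] using h
  rw [invCount, ← Finset.card_erase_add_one hmem, invCount]
  congr 1
  refine Finset.card_bij' (fun p _ => (simpleTransp a p.1, simpleTransp a p.2))
    (fun p _ => (simpleTransp a p.1, simpleTransp a p.2)) ?_ ?_ (by simp) (by simp)
  · rintro ⟨i, j⟩ hp
    simp only [inversions, Finset.mem_erase, Finset.mem_filter, Finset.mem_univ, true_and,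
      inv_simpleTransp_mul_apply, ne_eq, Prod.mk.injEq] at hp ⊢
    exact ⟨simpleTransp_lt a hp.2.1 hp.1, hp.2.2⟩
  · rintro ⟨i, j⟩ hp
    simp only [inversions, Finset.mem_erase, Finset.mem_filter, Finset.mem_univ, true_and,
      inv_simpleTransp_mul_apply, ne_eq, Prod.mk.injEq, simpleTransp_apply_self] at hp ⊢
    have hne : ¬ (i = lo a ∧ j = hi a) := by
      rintro ⟨rfl, rfl⟩
      exact absurd h hp.2.not_gt
    refine ⟨?_, simpleTransp_lt a hp.1 hne, hp.2⟩
    rintro ⟨h1, h2⟩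
    have h1' : i = hi a := by rw [← simpleTransp_apply_self a i, h1, simpleTransp_lo]
    have h2' : j = lo a := by rw [← simpleTransp_apply_self a j, h2, simpleTransp_hi]
    exact absurd hp.1 (by rw [h1', h2']; exact (lo_lt_hi a).not_gt)

theorem invCount_mul_of_gt (a : Fin (n - 1)) (w : Equiv.Perm (Fin n))
    (h : w⁻¹ (hi a) < w⁻¹ (lo a)) : invCount (simpleTransp a * w) + 1 = invCount w := by
  have := invCount_mul_of_lt a (simpleTransp a * w) (by
    simpa [inv_simpleTransp_mul_apply, -mul_inv_rev] using h)
  simpa using this.symm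

theorem inv_lo_lt_or_gt (a : Fin (n - 1)) (w : Equiv.Perm (Fin n)) :
    w⁻¹ (lo a) < w⁻¹ (hi a) ∨ w⁻¹ (hi a) < w⁻¹ (lo a) :=
  lt_or_gt_of_ne fun h => lo_ne_hi a (w⁻¹.injective h)

theorem invCount_mul_le (a : Fin (n - 1)) (w : Equiv.Perm (Fin n)) :
    invCount (simpleTransp a * w) ≤ invCount w + 1 := by
  rcases inv_lo_lt_or_gt a w with h | h
  · exact (invCount_mul_of_lt a w h).le
  · have := invCount_mul_of_gt a w h
    omega

theorem le_invCount_mul (a : Fin (n - 1)) (w : Equiv.Perm (Fin n)) :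
    invCount w ≤ invCount (simpleTransp a * w) + 1 := by
  simpa using invCount_mul_le a (simpleTransp a * w)

theorem inv_hi_lt_of_invCount_lt (a : Fin (n - 1)) {w : Equiv.Perm (Fin n)}
    (h : invCount (simpleTransp a * w) < invCount w) : w⁻¹ (hi a) < w⁻¹ (lo a) := by
  rcases inv_lo_lt_or_gt a w with h' | h'
  · have := invCount_mul_of_lt a w h'
    omega
  · exact h'

@[simp] theorem invCount_one : invCount (1 : Equiv.Perm (Fin n)) = 0 := by
  simp only [invCount, inversions, Finset.card_eq_zero, Finset.filter_eq_empty_iff]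
  intro p _ hp
  exact lt_asymm hp.1 (by simpa using hp.2)

/-- Without descents `w⁻¹` is strictly increasing, and the only order automorphism of `Fin n` is the
identity. -/
theorem exists_descent {w : Equiv.Perm (Fin n)} (hw : w ≠ 1) :
    ∃ a : Fin (n - 1), w⁻¹ (hi a) < w⁻¹ (lo a) := by
  by_contra! hcon
  apply hw
  have hstep : ∀ a : Fin (n - 1), w⁻¹ (lo a) < w⁻¹ (hi a) := fun a =>
    lt_of_le_of_ne (hcon a) fun h => lo_ne_hi a (w⁻¹.injective h)
  have hmono : StrictMono (w⁻¹ : Equiv.Perm (Fin n)) := by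
    -- Here `d` is the number of positions strictly between `i` and `j`.
    have key : ∀ d : ℕ, ∀ i j : Fin n, (j : ℕ) = i + d + 1 → w⁻¹ i < w⁻¹ j := by
      intro d
      induction d with
      | zero =>
        intro i j hij
        have h := hstep ⟨i, by omega⟩
        have e1 : lo (⟨i, by omega⟩ : Fin (n - 1)) = i := rfl
        have e2 : hi (⟨i, by omega⟩ : Fin (n - 1)) = j := Fin.ext (by simp [hi, hij])
        rwa [e1, e2] at h
      | succ d ih =>
        intro i j hij
        have hlt : (i : ℕ) + d + 1 < n := by omega
        refine (ih i ⟨i + d + 1, hlt⟩ rfl).trans ?_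
        have h := hstep ⟨i + d + 1, by omega⟩
        have e2 : hi (⟨i + d + 1, by omega⟩ : Fin (n - 1)) = j :=
          Fin.ext (by simp [hi, hij]; omega)
        rwa [e2] at h
    intro i j hij
    exact key (j - i - 1) i j (by have := Fin.lt_def.1 hij; omega)
  have hid : (w⁻¹ : Equiv.Perm (Fin n)) = 1 := by
    have hsub : Subsingleton (Fin n ≃o Fin n) := inferInstance
    have h2 := Subsingleton.elim
      (StrictMono.orderIsoOfSurjective _ hmono w⁻¹.surjective) (OrderIso.refl (Fin n))
    ext i
    have := congrArg (fun f : Fin n ≃o Fin n => f i) h2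
    simpa using congrArg Fin.val this
  exact inv_eq_one.1 hid

/-- Descents are peeled off one at a time. Together with `invCount_wordProd_le` this identifies
`invCount` with the minimal word length. -/
theorem exists_word_length_eq (w : Equiv.Perm (Fin n)) :
    ∃ l : List (Fin (n - 1)), wordProd l = w ∧ l.length = invCount w := by
  induction hm : invCount w generalizing w with
  | zero =>
    refine ⟨[], ?_, rfl⟩
    by_contra hne
    obtain ⟨a, ha⟩ := exists_descent (w := w) (fun h => hne (by simp [h]))
    have := invCount_mul_of_gt a w ha
    omega
  | succ m ih =>
    have hne : w ≠ 1 := by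
      rintro rfl
      simp at hm
    obtain ⟨a, ha⟩ := exists_descent hne
    have := invCount_mul_of_gt a w ha
    obtain ⟨l, hl, hlen⟩ := ih (simpleTransp a * w) (by omega)
    exact ⟨a :: l, by simp [hl], by simp [hlen]⟩

theorem invCount_wordProd_le (l : List (Fin (n - 1))) : invCount (wordProd l) ≤ l.length := by
  induction l with
  | nil => simp
  | cons a l ih =>
    have := invCount_mul_le a (wordProd l)
    simp only [wordProd_cons, List.length_cons]
    omega

theorem IsReducedExpr.length_eq {w : Equiv.Perm (Fin n)} {l : List (Fin (n - 1))}
    (h : IsReducedExpr w l) : l.length = invCount w := by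
  obtain ⟨l', hl', hlen⟩ := exists_word_length_eq w
  refine le_antisymm (hlen ▸ h.2 l' hl') ?_
  have := invCount_wordProd_le l
  rwa [h.1] at this

end Inversions

/-! ### Straightening products of the `σ_a` modulo shorter words. -/

section Relations

variable {k : Type*} [CommRing k] {n : ℕ} {J : Type*} [Fintype J] [DecidableEq J]
  (c : J → J) (Q : J → J → MvPolynomial (Fin 2) k)

namespace RC

theorem genE_mul_genE (μ ν : Fin n → J) :
    genE c Q μ * genE c Q ν = if μ = ν then genE c Q μ else 0 := by
  have h := mk_rel c Q (Rel.e_mul_e (k := k) μ ν)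
  rw [map_mul, apply_ite (mk c Q), map_zero] at h
  exact h

theorem sum_genE : ∑ ν : Fin n → J, genE c Q ν = 1 := by
  have h := mk_rel c Q (Rel.one (k := k) (n := n))
  rw [map_one, map_sum] at h
  exact h.symm

theorem genY_mul_genE (p : Fin n) (ν : Fin n → J) :
    genY c Q p * genE c Q ν = genE c Q ν * genY c Q p := by
  have h := mk_rel c Q (Rel.y_mul_e (k := k) p ν)
  rw [map_mul, map_mul] at h
  exact h

theorem genC_mul_genE (p : Fin n) (ν : Fin n → J) :
    genC c Q p * genE c Q ν = genE c Q (Function.update ν p (c (ν p))) * genC c Q p := by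
  have h := mk_rel c Q (Rel.c_mul_e (k := k) p ν)
  rw [map_mul, map_mul] at h
  exact h

theorem genY_mul_genY (p q : Fin n) :
    genY c Q p * genY c Q q = genY c Q q * genY c Q p := by
  have h := mk_rel c Q (Rel.y_mul_y (k := k) p q)
  rw [map_mul, map_mul] at h
  exact h

theorem genC_mul_genC (p q : Fin n) :
    genC c Q p * genC c Q q + genC c Q q * genC c Q p = if p = q then 2 else 0 := by
  have h := mk_rel c Q (Rel.c_mul_c (k := k) p q)
  rw [map_add, map_mul, map_mul, apply_ite (mk c Q), map_ofNat, map_zero] at h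
  exact h

theorem genC_mul_genY (p q : Fin n) :
    genC c Q p * genY c Q q = (if p = q then -1 else 1) * (genY c Q q * genC c Q p) := by
  have h := mk_rel c Q (Rel.c_mul_y (k := k) p q)
  rw [map_mul, map_mul, map_mul, apply_ite (mk c Q), map_neg, map_one] at h
  exact h

theorem genS_mul_genE (a : Fin (n - 1)) (ν : Fin n → J) :
    genS c Q a * genE c Q ν = genE c Q (ν ∘ simpleTransp a) * genS c Q a := by
  have h := mk_rel c Q (Rel.s_mul_e (k := k) a ν)
  rw [map_mul, map_mul] at h
  exact h

theorem genS_mul_genC (a : Fin (n - 1)) (p : Fin n) :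
    genS c Q a * genC c Q p = genC c Q (simpleTransp a p) * genS c Q a := by
  have h := mk_rel c Q (Rel.s_mul_c (k := k) a p)
  rw [map_mul, map_mul] at h
  exact h

theorem genS_mul_genY_mul_genE (a : Fin (n - 1)) (p : Fin n) (ν : Fin n → J)
    (h : p ≠ lo a) (h' : p ≠ hi a) :
    genS c Q a * genY c Q p * genE c Q ν = genY c Q p * genS c Q a * genE c Q ν := by
  have h := mk_rel c Q (Rel.s_mul_y (k := k) a p ν h h')
  simp only [map_mul] at h
  exact h

theorem genS_mul_genY_hi_mul_genE (a : Fin (n - 1)) (ν : Fin n → J) :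
    (genS c Q a * genY c Q (hi a) - genY c Q (lo a) * genS c Q a) * genE c Q ν =
      (if ν (lo a) = ν (hi a) then genE c Q ν else 0)
        - (if ν (lo a) = c (ν (hi a)) then
            genC c Q (lo a) * genC c Q (hi a) * genE c Q ν else 0) := by
  have h := mk_rel c Q (Rel.s_mul_y_hi (k := k) a ν)
  simp only [map_mul, map_sub, apply_ite (mk c Q), map_zero] at h
  exact h

theorem genY_hi_mul_genS_mul_genE (a : Fin (n - 1)) (ν : Fin n → J) :
    (genY c Q (hi a) * genS c Q a - genS c Q a * genY c Q (lo a)) * genE c Q ν =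
      (if ν (lo a) = ν (hi a) then genE c Q ν else 0)
        + (if ν (lo a) = c (ν (hi a)) then
            genC c Q (lo a) * genC c Q (hi a) * genE c Q ν else 0) := by
  have h := mk_rel c Q (Rel.y_hi_mul_s (k := k) a ν)
  simp only [map_mul, map_sub, map_add, apply_ite (mk c Q), map_zero] at h
  exact h

theorem genS_mul_genS_comm (a b : Fin (n - 1)) (hab : (a : ℕ) + 1 < b) :
    genS c Q a * genS c Q b = genS c Q b * genS c Q a := by
  have h := mk_rel c Q (Rel.s_comm (k := k) (J := J) a b hab)
  rw [map_mul, map_mul] at h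
  exact h

@[simp] theorem sWord_nil : sWord c Q ([] : List (Fin (n - 1))) = 1 := rfl

@[simp] theorem sWord_cons (a : Fin (n - 1)) (l : List (Fin (n - 1))) :
    sWord c Q (a :: l) = genS c Q a * sWord c Q l := by
  simp [sWord]

/-- The subalgebra generated by the `y_p`, `c_p` and `e(ν)`. -/
noncomputable def baseAlg (n : ℕ) : Subalgebra k (RC n c Q) :=
  Algebra.adjoin k (Set.range (genY c Q) ∪ Set.range (genC c Q) ∪ Set.range (genE c Q))

theorem genY_mem (p : Fin n) : genY c Q p ∈ baseAlg c Q n :=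
  Algebra.subset_adjoin (Or.inl (Or.inl ⟨p, rfl⟩))

theorem genC_mem (p : Fin n) : genC c Q p ∈ baseAlg c Q n :=
  Algebra.subset_adjoin (Or.inl (Or.inr ⟨p, rfl⟩))

theorem genE_mem (ν : Fin n → J) : genE c Q ν ∈ baseAlg c Q n :=
  Algebra.subset_adjoin (Or.inr ⟨ν, rfl⟩)

theorem mk_fpoly_mem (P : MvPolynomial (Fin n) k) : mk c Q (fpoly J P) ∈ baseAlg c Q n := by
  rw [fpoly, map_sum]
  refine sum_mem fun m _ => ?_
  rw [map_smul, map_list_prod]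
  refine Subalgebra.smul_mem _ (list_prod_mem fun x hx => ?_) _
  simp only [List.map_ofFn, List.mem_ofFn, Function.comp_apply, map_pow] at hx
  obtain ⟨p, rfl⟩ := hx
  exact pow_mem (genY_mem c Q p) _

/-- Several relations are given only after right multiplication by an `e(ν)`; since the `e(ν)` sum
to `1`, nothing is lost. -/
theorem mem_of_forall_mul_genE_mem {S : Subalgebra k (RC n c Q)} {x : RC n c Q}
    (h : ∀ ν, x * genE c Q ν ∈ S) : x ∈ S := by
  rw [← mul_one x, ← sum_genE, Finset.mul_sum]
  exact sum_mem fun ν _ => h ν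

theorem eq_of_forall_mul_genE {x z : RC n c Q}
    (h : ∀ ν, x * genE c Q ν = z * genE c Q ν) : x = z := by
  rw [← mul_one x, ← mul_one z, ← sum_genE, Finset.mul_sum, Finset.mul_sum]
  exact Finset.sum_congr rfl fun ν _ => h ν

theorem genS_mul_genS_mem (a : Fin (n - 1)) : genS c Q a * genS c Q a ∈ baseAlg c Q n := by
  refine mem_of_forall_mul_genE_mem c Q fun ν => ?_
  have h := mk_rel c Q (Rel.s_mul_s (c := c) (Q := Q) a ν)
  simp only [map_mul] at h
  refine (congrArg (· ∈ baseAlg c Q n) h).mpr ?_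
  exact mul_mem (mk_fpoly_mem c Q _) (genE_mem c Q ν)

theorem braid_mem (a b : Fin (n - 1)) (hab : (b : ℕ) = a + 1) :
    genS c Q b * genS c Q a * genS c Q b - genS c Q a * genS c Q b * genS c Q a
      ∈ baseAlg c Q n := by
  refine mem_of_forall_mul_genE_mem c Q fun ν => ?_
  have h := mk_rel c Q (Rel.braid (c := c) (Q := Q) a b hab ν)
  simp only [map_mul, map_sub, map_add, apply_ite (mk c Q), map_zero] at h
  refine (congrArg (· ∈ baseAlg c Q n) h).mpr ?_
  refine add_mem ?_ ?_ <;> split_ifs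
  · exact mul_mem (mk_fpoly_mem c Q _) (genE_mem c Q ν)
  · exact zero_mem _
  · exact mul_mem (mul_mem (mk_fpoly_mem c Q _)
      (mul_mem (genC_mem c Q _) (genC_mem c Q _))) (genE_mem c Q ν)
  · exact zero_mem _

/-- The property is stable under sums and products, so it need only be checked on the generators of
`baseAlg`. A correction `x''` arises only for `y_a` and `y_{a+1}`. -/
theorem exists_genS_mul_eq (a : Fin (n - 1)) {x : RC n c Q} (hx : x ∈ baseAlg c Q n) :
    ∃ x' ∈ baseAlg c Q n, ∃ x'' ∈ baseAlg c Q n, genS c Q a * x = x' * genS c Q a + x'' := by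
  induction hx using Algebra.adjoin_induction with
  | mem x hx =>
    rcases hx with (⟨p, rfl⟩ | ⟨p, rfl⟩) | ⟨ν, rfl⟩
    · by_cases h1 : p = lo a
      · refine ⟨genY c Q (hi a), genY_mem c Q _,
          -(genY c Q (hi a) * genS c Q a - genS c Q a * genY c Q (lo a)),
          neg_mem (mem_of_forall_mul_genE_mem c Q fun ν => ?_), by rw [h1]; abel⟩
        rw [genY_hi_mul_genS_mul_genE]
        refine add_mem ?_ ?_ <;> split_ifs
        · exact genE_mem c Q ν
        · exact zero_mem _
        · exact mul_mem (mul_mem (genC_mem c Q _) (genC_mem c Q _)) (genE_mem c Q ν)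
        · exact zero_mem _
      · by_cases h2 : p = hi a
        · refine ⟨genY c Q (lo a), genY_mem c Q _,
            (genS c Q a * genY c Q (hi a) - genY c Q (lo a) * genS c Q a),
            mem_of_forall_mul_genE_mem c Q fun ν => ?_, by rw [h2]; abel⟩
          rw [genS_mul_genY_hi_mul_genE]
          refine sub_mem ?_ ?_ <;> split_ifs
          · exact genE_mem c Q ν
          · exact zero_mem _
          · exact mul_mem (mul_mem (genC_mem c Q _) (genC_mem c Q _)) (genE_mem c Q ν)
          · exact zero_mem _
        · refine ⟨genY c Q p, genY_mem c Q p, 0, zero_mem _, ?_⟩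
          rw [add_zero]
          exact eq_of_forall_mul_genE c Q fun ν => genS_mul_genY_mul_genE c Q a p ν h1 h2
    · exact ⟨_, genC_mem c Q _, 0, zero_mem _, by rw [add_zero, genS_mul_genC]⟩
    · exact ⟨_, genE_mem c Q _, 0, zero_mem _, by rw [add_zero, genS_mul_genE]⟩
  | algebraMap r =>
    exact ⟨_, Subalgebra.algebraMap_mem _ r, 0, zero_mem _, by
      rw [add_zero, Algebra.commutes]⟩
  | add x z _ _ hx hz =>
    obtain ⟨x1, h1, x2, h2, hx⟩ := hx
    obtain ⟨z1, h3, z2, h4, hz⟩ := hz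
    exact ⟨_, add_mem h1 h3, _, add_mem h2 h4, by rw [mul_add, hx, hz]; noncomm_ring⟩
  | mul x z _ hzm hx hz =>
    obtain ⟨x1, h1, x2, h2, hx⟩ := hx
    obtain ⟨z1, h3, z2, h4, hz⟩ := hz
    exact ⟨_, mul_mem h1 h3, _, add_mem (mul_mem h1 h4) (mul_mem h2 hzm), by
      rw [← mul_assoc, hx, add_mul, mul_assoc, hz]; noncomm_ring⟩

/-- The span of the elements `x σ_{i_1} ⋯ σ_{i_l}`, `l < m`, with `x` in `baseAlg`. -/
noncomputable def filt (n m : ℕ) : Submodule k (RC n c Q) :=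
  Submodule.span k {z | ∃ x ∈ baseAlg c Q n, ∃ l : List (Fin (n - 1)),
    l.length < m ∧ z = x * sWord c Q l}

theorem mul_sWord_mem_filt {m : ℕ} {x : RC n c Q} (hx : x ∈ baseAlg c Q n)
    {l : List (Fin (n - 1))} (hl : l.length < m) : x * sWord c Q l ∈ filt c Q n m :=
  Submodule.subset_span ⟨x, hx, l, hl, rfl⟩

theorem sWord_mem_filt {m : ℕ} {l : List (Fin (n - 1))} (hl : l.length < m) :
    sWord c Q l ∈ filt c Q n m := by
  simpa using mul_sWord_mem_filt c Q (one_mem _) hl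

theorem filt_mono {m m' : ℕ} (h : m ≤ m') : filt c Q n m ≤ filt c Q n m' := by
  refine Submodule.span_mono ?_
  rintro _ ⟨x, hx, l, hl, rfl⟩
  exact ⟨x, hx, l, hl.trans_le h, rfl⟩

theorem mul_mem_filt {m : ℕ} {x z : RC n c Q} (hx : x ∈ baseAlg c Q n) (hz : z ∈ filt c Q n m) :
    x * z ∈ filt c Q n m := by
  induction hz using Submodule.span_induction with
  | mem z hz =>
    obtain ⟨x', hx', l, hl, rfl⟩ := hz
    rw [← mul_assoc]
    exact mul_sWord_mem_filt c Q (mul_mem hx hx') hl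
  | zero => rw [mul_zero]; exact zero_mem _
  | add z z' _ _ h h' => rw [mul_add]; exact add_mem h h'
  | smul r z _ h => rw [mul_smul_comm]; exact Submodule.smul_mem _ _ h

theorem genS_mul_mem_filt {m : ℕ} (a : Fin (n - 1)) {z : RC n c Q} (hz : z ∈ filt c Q n m) :
    genS c Q a * z ∈ filt c Q n (m + 1) := by
  induction hz using Submodule.span_induction with
  | mem z hz =>
    obtain ⟨x, hx, l, hl, rfl⟩ := hz
    obtain ⟨x', hx', x'', hx'', h⟩ := exists_genS_mul_eq c Q a hx
    rw [← mul_assoc, h, add_mul, mul_assoc, ← sWord_cons]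
    exact add_mem (mul_sWord_mem_filt c Q hx' (by simpa using hl))
      (mul_sWord_mem_filt c Q hx'' (by omega))
  | zero => rw [mul_zero]; exact zero_mem _
  | add z z' _ _ h h' => rw [mul_add]; exact add_mem h h'
  | smul r z _ h => rw [mul_smul_comm]; exact Submodule.smul_mem _ _ h

theorem hi_eq_lo {a b : Fin (n - 1)} (hab : (b : ℕ) = a + 1) : hi a = lo b :=
  Fin.ext (by simp [lo, hi, hab])

end RC

theorem simpleTransp_commute {a b : Fin (n - 1)} (hab : (a : ℕ) + 1 < b) :
    simpleTransp a * simpleTransp b = simpleTransp b * simpleTransp a := by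
  refine Equiv.Perm.Disjoint.commute fun p => ?_
  by_cases h1 : p = lo a
  · right
    apply simpleTransp_of_ne <;> simp [h1, lo, hi, Fin.ext_iff] <;> omega
  · by_cases h2 : p = hi a
    · right
      apply simpleTransp_of_ne <;> simp [h2, lo, hi, Fin.ext_iff] <;> omega
    · exact Or.inl (simpleTransp_of_ne a h1 h2)

theorem simpleTransp_braid {a b : Fin (n - 1)} (hab : (b : ℕ) = a + 1) :
    simpleTransp a * simpleTransp b * simpleTransp a =
      simpleTransp b * simpleTransp a * simpleTransp b := by
  have h1 : hi a = lo b := RC.hi_eq_lo hab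
  have h2 : lo a ≠ hi b := by simp [lo, hi, Fin.ext_iff, hab]; omega
  have e1 := Equiv.swap_mul_swap_mul_swap (lo_ne_hi a) h2
  have e2 := Equiv.swap_mul_swap_mul_swap (h1 ▸ (lo_ne_hi b).symm) h2.symm
  rw [simpleTransp, simpleTransp, ← h1, e1, Equiv.swap_comm (hi b) (lo a), ← e2,
    Equiv.swap_comm (hi b), Equiv.swap_comm (hi a) (lo a)]

namespace RC

/-- Exchange argument: `a` and `b` are both left descents of `w`, so `w = s_a s_b u` with `u`
shorter by two. For a reduced word `q` of `u`, induction replaces `r` by `b :: q` and `r'` by `a ::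
q`, after which `σ_a` and `σ_b` commute. -/
theorem sWord_sub_mem_filt_of_far {m : ℕ}
    (ih : ∀ l l' : List (Fin (n - 1)), l.length = m → l'.length = m →
      wordProd l = wordProd l' → invCount (wordProd l) = m →
      sWord c Q l - sWord c Q l' ∈ filt c Q n m)
    {a b : Fin (n - 1)} (hab : (a : ℕ) + 1 < b) {r r' : List (Fin (n - 1))}
    (hr : r.length = m) (hr' : r'.length = m)
    (h : wordProd (a :: r) = wordProd (b :: r'))
    (hinv : invCount (wordProd (a :: r)) = m + 1) :
    sWord c Q (a :: r) - sWord c Q (b :: r') ∈ filt c Q n (m + 1) := by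
  obtain ⟨w, hw⟩ : ∃ w, w = wordProd (a :: r) := ⟨_, rfl⟩
  have hwr : simpleTransp a * w = wordProd r := by simp [hw]
  have hwr' : simpleTransp b * w = wordProd r' := by simp [hw, h]
  have ha := inv_hi_lt_of_invCount_lt a (w := w) (by
    have := invCount_wordProd_le r
    rw [hwr, hw]; omega)
  have hb := inv_hi_lt_of_invCount_lt b (w := w) (by
    have := invCount_wordProd_le r'
    rw [hwr', hw]; omega)
  have hlo : simpleTransp a (lo b) = lo b := by
    apply simpleTransp_of_ne <;> simp [lo, hi, Fin.ext_iff] <;> omega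
  have hhi : simpleTransp a (hi b) = hi b := by
    apply simpleTransp_of_ne <;> simp [lo, hi, Fin.ext_iff] <;> omega
  have e1 := invCount_mul_of_gt a w ha
  have e2 := invCount_mul_of_gt b (simpleTransp a * w) (by
    rw [inv_simpleTransp_mul_apply, inv_simpleTransp_mul_apply, hlo, hhi]; exact hb)
  obtain ⟨q, hq, hql⟩ := exists_word_length_eq (simpleTransp b * (simpleTransp a * w))
  rw [← hw] at hinv
  have hq' : wordProd q = simpleTransp a * (simpleTransp b * w) := by
    rw [hq, ← mul_assoc, ← mul_assoc, simpleTransp_commute hab]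
  have d1 := genS_mul_mem_filt c Q a (ih r (b :: q) hr (by simp; omega)
    (by rw [← hwr]; simp [hq]) (by rw [← hwr]; omega))
  have d2 := genS_mul_mem_filt c Q b (ih r' (a :: q) hr' (by simp; omega)
    (by rw [← hwr']; simp [hq']) (by rw [← hwr']; have := invCount_mul_of_gt b w hb; omega))
  have e : sWord c Q (a :: r) - sWord c Q (b :: r') =
      genS c Q a * (sWord c Q r - sWord c Q (b :: q))
        - genS c Q b * (sWord c Q r' - sWord c Q (a :: q)) := by
    simp only [sWord_cons, mul_sub, ← mul_assoc, genS_mul_genS_comm c Q a b hab]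
    abel
  rw [e]
  exact sub_mem d1 d2

/-- As in the commuting case, but now `w = s_a s_b s_a u` with `u` shorter by three. Passing between
the two braid words costs an element of `baseAlg` times the word of `u`, which is short enough. -/
theorem sWord_sub_mem_filt_of_adj {m : ℕ}
    (ih : ∀ l l' : List (Fin (n - 1)), l.length = m → l'.length = m →
      wordProd l = wordProd l' → invCount (wordProd l) = m →
      sWord c Q l - sWord c Q l' ∈ filt c Q n m)
    {a b : Fin (n - 1)} (hab : (b : ℕ) = a + 1) {r r' : List (Fin (n - 1))}
    (hr : r.length = m) (hr' : r'.length = m)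
    (h : wordProd (a :: r) = wordProd (b :: r'))
    (hinv : invCount (wordProd (a :: r)) = m + 1) :
    sWord c Q (a :: r) - sWord c Q (b :: r') ∈ filt c Q n (m + 1) := by
  obtain ⟨w, hw⟩ : ∃ w, w = wordProd (a :: r) := ⟨_, rfl⟩
  have hwr : simpleTransp a * w = wordProd r := by simp [hw]
  have hwr' : simpleTransp b * w = wordProd r' := by simp [hw, h]
  have ha := inv_hi_lt_of_invCount_lt a (w := w) (by
    have := invCount_wordProd_le r
    rw [hwr, hw]; omega)
  have hb := inv_hi_lt_of_invCount_lt b (w := w) (by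
    have := invCount_wordProd_le r'
    rw [hwr', hw]; omega)
  have hlb : hi a = lo b := hi_eq_lo hab
  have hhi : simpleTransp a (hi b) = hi b := by
    apply simpleTransp_of_ne <;> simp [lo, hi, Fin.ext_iff] <;> omega
  have hlo : simpleTransp b (lo a) = lo a := by
    apply simpleTransp_of_ne <;> simp [lo, hi, Fin.ext_iff] <;> omega
  have e1 := invCount_mul_of_gt a w ha
  have e2 := invCount_mul_of_gt b (simpleTransp a * w) (by
    rw [inv_simpleTransp_mul_apply, inv_simpleTransp_mul_apply, ← hlb, hhi, simpleTransp_hi]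
    exact hb.trans (hlb ▸ ha))
  -- The pair `(lo a, hi a)` for `s_b s_a w` is the pair `(lo b, hi b)` for `w`, a descent by `hb`.
  have e3 := invCount_mul_of_gt a (simpleTransp b * (simpleTransp a * w)) (by
    simp only [inv_simpleTransp_mul_apply]
    rw [hlo, simpleTransp_lo, hlb, simpleTransp_lo, hhi]
    exact hb)
  obtain ⟨q, hq, hql⟩ :=
    exists_word_length_eq (simpleTransp a * (simpleTransp b * (simpleTransp a * w)))
  rw [← hw] at hinv
  have hq' : wordProd q = simpleTransp b * (simpleTransp a * (simpleTransp b * w)) := by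
    rw [hq, ← mul_assoc, ← mul_assoc, simpleTransp_braid hab, mul_assoc, mul_assoc]
  have d1 := genS_mul_mem_filt c Q a (ih r (b :: a :: q) hr (by simp; omega)
    (by rw [← hwr]; simp [hq]) (by rw [← hwr]; omega))
  have d2 := genS_mul_mem_filt c Q b (ih r' (a :: b :: q) hr' (by simp; omega)
    (by rw [← hwr']; simp [hq']) (by rw [← hwr']; have := invCount_mul_of_gt b w hb; omega))
  have d3 := mul_sWord_mem_filt c Q (braid_mem c Q a b hab) (show q.length < m + 1 by omega)
  have e : sWord c Q (a :: r) - sWord c Q (b :: r') =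
      genS c Q a * (sWord c Q r - sWord c Q (b :: a :: q))
        - genS c Q b * (sWord c Q r' - sWord c Q (a :: b :: q))
        - (genS c Q b * genS c Q a * genS c Q b - genS c Q a * genS c Q b * genS c Q a)
          * sWord c Q q := by
    simp only [sWord_cons]
    noncomm_ring
  rw [e]
  exact sub_mem (sub_mem d1 d2) d3

/-- Two reduced words with the same product give the same element up to terms of smaller
length. -/
theorem sWord_sub_mem_filt {m : ℕ} (l l' : List (Fin (n - 1))) (hl : l.length = m)
    (hl' : l'.length = m) (h : wordProd l = wordProd l') (hinv : invCount (wordProd l) = m) :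
    sWord c Q l - sWord c Q l' ∈ filt c Q n m := by
  induction m generalizing l l' with
  | zero =>
    rw [List.length_eq_zero_iff] at hl hl'
    rw [hl, hl', sub_self]
    exact zero_mem _
  | succ m ih =>
    obtain ⟨a, r, rfl⟩ := List.exists_cons_of_length_eq_add_one hl
    obtain ⟨b, r', rfl⟩ := List.exists_cons_of_length_eq_add_one hl'
    have hr : r.length = m := by simpa using hl
    have hr' : r'.length = m := by simpa using hl'
    have hinv' : invCount (wordProd (b :: r')) = m + 1 := h ▸ hinv
    rcases lt_trichotomy (a : ℕ) b with hlt | heq | hgt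
    · rcases (Nat.succ_le_of_lt hlt).eq_or_lt with he | hlt'
      · exact sWord_sub_mem_filt_of_adj c Q ih he.symm hr hr' h hinv
      · exact sWord_sub_mem_filt_of_far c Q ih hlt' hr hr' h hinv
    · obtain rfl : a = b := Fin.ext heq
      have hrr : wordProd r = wordProd r' := by simpa using h
      rw [sWord_cons, sWord_cons, ← mul_sub]
      refine genS_mul_mem_filt c Q a (ih r r' hr hr' hrr ?_)
      have h1 := invCount_wordProd_le r
      have h2 := invCount_mul_le a (wordProd r)
      rw [wordProd_cons] at hinv
      omega
    · rw [← neg_sub]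
      refine neg_mem ?_
      rcases (Nat.succ_le_of_lt hgt).eq_or_lt with he | hlt'
      · exact sWord_sub_mem_filt_of_adj c Q ih he.symm hr' hr h.symm hinv'
      · exact sWord_sub_mem_filt_of_far c Q ih hlt' hr' hr h.symm hinv'

/-- If `r` is reduced but `a :: r` is not, then `a` is a descent of the product of `r`. So `r` may
be replaced by a reduced word starting with `a`, and `σ_a²` lies in `baseAlg`. -/
theorem sWord_mem_filt_of_not_reduced (l : List (Fin (n - 1)))
    (h : invCount (wordProd l) < l.length) : sWord c Q l ∈ filt c Q n l.length := by
  induction l with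
  | nil => simp at h
  | cons a r ih =>
    rw [List.length_cons] at h ⊢
    rcases (invCount_wordProd_le r).lt_or_eq with hlt | heq
    · rw [sWord_cons]
      exact genS_mul_mem_filt c Q a (ih hlt)
    · rw [wordProd_cons] at h
      have hd : invCount (simpleTransp a * wordProd r) + 1 = invCount (wordProd r) := by
        rcases inv_lo_lt_or_gt a (wordProd r) with h' | h'
        · have := invCount_mul_of_lt a _ h'
          omega
        · exact invCount_mul_of_gt a _ h'
      obtain ⟨q, hq, hql⟩ := exists_word_length_eq (simpleTransp a * wordProd r)
      have d1 := genS_mul_mem_filt c Q a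
        (sWord_sub_mem_filt c Q r (a :: q) rfl (by simp; omega) (by simp [hq]) heq)
      have d2 := mul_sWord_mem_filt c Q (genS_mul_genS_mem c Q a)
        (show q.length < r.length + 1 by omega)
      have e : sWord c Q (a :: r) = genS c Q a * (sWord c Q r - sWord c Q (a :: q))
          + genS c Q a * genS c Q a * sWord c Q q := by
        simp only [sWord_cons]
        noncomm_ring
      rw [e]
      exact add_mem d1 d2

theorem exists_mem_filt (z : RC n c Q) : ∃ m, z ∈ filt c Q n m := by
  suffices h : ∀ x : FreeAlgebra k (Gen n J), ∀ m, ∀ z ∈ filt c Q n m,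
      ∃ m', mk c Q x * z ∈ filt c Q n m' by
    obtain ⟨x, rfl⟩ := RingQuot.mkAlgHom_surjective k (Rel c Q) z
    -- Lengths in `filt` are strictly below the index, so the empty word sits at index `1`, not `0`.
    obtain ⟨m, hm⟩ := h x 1 1 (sWord_mem_filt c Q (l := []) (by simp))
    exact ⟨m, by rw [mul_one] at hm; exact hm⟩
  intro x
  induction x using FreeAlgebra.induction with
  | grade0 r =>
    intro m z hz
    refine ⟨m, ?_⟩
    rw [AlgHom.commutes, ← Algebra.smul_def]
    exact Submodule.smul_mem _ _ hz
  | grade1 g =>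
    intro m z hz
    cases g with
    | y p => exact ⟨m, mul_mem_filt c Q (genY_mem c Q p) hz⟩
    | c p => exact ⟨m, mul_mem_filt c Q (genC_mem c Q p) hz⟩
    | s a => exact ⟨m + 1, genS_mul_mem_filt c Q a hz⟩
    | e ν => exact ⟨m, mul_mem_filt c Q (genE_mem c Q ν) hz⟩
  | mul x x' hx hx' =>
    intro m z hz
    obtain ⟨m', h'⟩ := hx' m z hz
    obtain ⟨m'', h''⟩ := hx m' _ h'
    exact ⟨m'', by rwa [map_mul, mul_assoc]⟩
  | add x x' hx hx' =>
    intro m z hz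
    obtain ⟨m', h'⟩ := hx' m z hz
    obtain ⟨m'', h''⟩ := hx m z hz
    exact ⟨max m' m'', by
      rw [map_add, add_mul]
      exact add_mem (filt_mono c Q (le_max_right _ _) h'')
        (filt_mono c Q (le_max_left _ _) h')⟩

end RC

end Relations

/-! ### Ordered monomials in commuting or anticommuting elements. -/

section OrderedProducts

theorem mul_prod_ofFn_pow_of_commute {R : Type*} [Monoid R] {n : ℕ} (f : Fin n → R)
    (hf : ∀ p q, Commute (f p) (f q)) (a : Fin n → ℕ) (p : Fin n) :
    f p * (List.ofFn fun q => f q ^ a q).prod =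
      (List.ofFn fun q => f q ^ (a + Pi.single p 1 : Fin n → ℕ) q).prod := by
  induction n with
  | zero => exact p.elim0
  | succ n ih =>
    simp only [List.ofFn_succ, List.prod_cons]
    refine Fin.cases ?_ (fun p => ?_) p
    · have h : ∀ q : Fin n, (Pi.single (0 : Fin (n + 1)) 1 : Fin (n + 1) → ℕ) q.succ = 0 :=
        fun q => Pi.single_eq_of_ne (Fin.succ_ne_zero q) _
      simp only [Pi.add_apply, Pi.single_eq_same, h, add_zero, ← mul_assoc, pow_succ']
    · have h : ∀ q : Fin n, (Pi.single p.succ 1 : Fin (n + 1) → ℕ) q.succ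
          = (Pi.single p 1 : Fin n → ℕ) q := fun q => by
        simp [Pi.single_apply]
      have h0 : (Pi.single p.succ 1 : Fin (n + 1) → ℕ) 0 = 0 :=
        Pi.single_eq_of_ne (Fin.succ_ne_zero p).symm _
      have := ih (fun q => f q.succ) (fun p q => hf _ _) (fun q => a q.succ) p
      simp only [Pi.add_apply] at this ⊢
      rw [← mul_assoc, ((hf p.succ 0).pow_right (a 0)).eq, mul_assoc, this]
      simp only [h, h0, add_zero]

/-- The sign is left unspecified because it is needed only up to a unit, for spanning. -/
theorem exists_mul_prod_ofFn_pow_of_anticommute {R : Type*} [Ring R] {n : ℕ} (f : Fin n → R)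
    (hsq : ∀ p, f p * f p = 1) (hf : ∀ p q, p ≠ q → f p * f q = -(f q * f p))
    (η : Fin n → ZMod 2) (p : Fin n) :
    ∃ ε : ℤˣ, f p * (List.ofFn fun q => f q ^ (η q).val).prod =
      ε • (List.ofFn fun q => f q ^ ((η + Pi.single p 1 : Fin n → ZMod 2) q).val).prod := by
  induction n with
  | zero => exact p.elim0
  | succ n ih =>
    simp only [List.ofFn_succ, List.prod_cons]
    refine Fin.cases ?_ (fun p => ?_) p
    · have h : ∀ q : Fin n, (Pi.single (0 : Fin (n + 1)) 1 : Fin (n + 1) → ZMod 2) q.succ = 0 :=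
        fun q => Pi.single_eq_of_ne (Fin.succ_ne_zero q) _
      refine ⟨1, ?_⟩
      simp only [Pi.add_apply, Pi.single_eq_same, h, add_zero, ← mul_assoc, one_smul]
      congr 1
      rcases (by decide : ∀ i : ZMod 2, i = 0 ∨ i = 1) (η 0) with h | h
      · simp [h, ZMod.val_one]
      · have h2 : (1 + 1 : ZMod 2) = 0 := by decide
        simp [h, ZMod.val_one, hsq, h2]
    · have h : ∀ q : Fin n, (Pi.single p.succ 1 : Fin (n + 1) → ZMod 2) q.succ
          = (Pi.single p 1 : Fin n → ZMod 2) q := fun q => by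
        simp [Pi.single_apply]
      have h0 : (Pi.single p.succ 1 : Fin (n + 1) → ZMod 2) 0 = 0 :=
        Pi.single_eq_of_ne (Fin.succ_ne_zero p).symm _
      obtain ⟨ε, hε⟩ := ih (fun q => f q.succ) (fun q => hsq _)
        (fun p q hpq => hf _ _ (by simpa using hpq)) (fun q => η q.succ) p
      simp only [Pi.add_apply] at hε ⊢
      obtain ⟨δ, hδ⟩ : ∃ δ : ℤˣ, f p.succ * f 0 ^ (η 0).val
          = δ • (f 0 ^ (η 0).val * f p.succ) := by
        rcases (by decide : ∀ i : ZMod 2, i = 0 ∨ i = 1) (η 0) with h | h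
        · exact ⟨1, by simp [h]⟩
        · exact ⟨-1, by simp [h, ZMod.val_one, hf p.succ 0 (Fin.succ_ne_zero p)]⟩
      refine ⟨δ * ε, ?_⟩
      rw [← mul_assoc, hδ, smul_mul_assoc, mul_assoc, hε]
      simp only [h, h0, add_zero, mul_smul_comm, smul_smul]

theorem exists_mul_list_prod {R : Type*} [Ring R] {n : ℕ} (x : R) (f : Fin n → R)
    (h : ∀ p, ∃ ε : ℤˣ, x * f p = ε • (f p * x)) :
    ∃ ε : ℤˣ, x * (List.ofFn f).prod = ε • ((List.ofFn f).prod * x) := by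
  induction n with
  | zero => exact ⟨1, by simp⟩
  | succ n ih =>
    obtain ⟨ε, hε⟩ := h 0
    obtain ⟨δ, hδ⟩ := ih (fun p => f p.succ) fun p => h _
    refine ⟨ε * δ, ?_⟩
    rw [List.ofFn_succ, List.prod_cons, ← mul_assoc, hε, smul_mul_assoc, mul_assoc, hδ,
      mul_smul_comm, smul_smul, mul_assoc]

theorem exists_mul_pow_eq {R : Type*} [Ring R] {x z : R} (h : ∃ ε : ℤˣ, x * z = ε • (z * x))
    (m : ℕ) : ∃ ε : ℤˣ, x * z ^ m = ε • (z ^ m * x) := by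
  induction m with
  | zero => exact ⟨1, by simp⟩
  | succ m ih =>
    obtain ⟨ε, hε⟩ := h
    obtain ⟨δ, hδ⟩ := ih
    exact ⟨δ * ε, by
      rw [pow_succ, ← mul_assoc, hδ, smul_mul_assoc, mul_assoc, hε, mul_smul_comm, smul_smul,
        mul_assoc]⟩

theorem exists_mul_list_prod_eq_mul {R ι : Type*} [Monoid R] (e : ι → R) (l : List R)
    (h : ∀ x ∈ l, ∀ i, ∃ j, e i * x = x * e j) (i : ι) : ∃ j, e i * l.prod = l.prod * e j := by
  induction l generalizing i with
  | nil => exact ⟨i, by simp⟩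
  | cons x l ih =>
    obtain ⟨j, hj⟩ := h x (by simp) i
    obtain ⟨j', hj'⟩ := ih (fun x hx => h x (by simp [hx])) j
    exact ⟨j', by rw [List.prod_cons, ← mul_assoc, hj, mul_assoc, hj', mul_assoc]⟩

end OrderedProducts

/-! ### The proposed basis spans. -/

section Spanning

variable {k : Type*} [CommRing k] {n : ℕ} {J : Type*} [Fintype J] [DecidableEq J]
  (c : J → J) (Q : J → J → MvPolynomial (Fin 2) k)

namespace RC

theorem genY_mul_yPow (p : Fin n) (a : Fin n → ℕ) :
    genY c Q p * yPow c Q a = yPow c Q (a + Pi.single p 1) :=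
  mul_prod_ofFn_pow_of_commute _ (fun p q => genY_mul_genY c Q p q) a p

/-- The defining relation reads `2 c_p² = 2`; dividing it requires `2` to be invertible. -/
theorem genC_mul_self [Invertible (2 : k)] (p : Fin n) : genC c Q p * genC c Q p = 1 := by
  have h := genC_mul_genC c Q p p
  rw [if_pos rfl] at h
  have h1 := half_add_self c Q (1 : RC n c Q)
  rw [one_add_one_eq_two, ← h, half_add_self] at h1
  exact h1

theorem genC_mul_genC_of_ne {p q : Fin n} (h : p ≠ q) :
    genC c Q p * genC c Q q = -(genC c Q q * genC c Q p) := by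
  have := genC_mul_genC c Q p q
  rw [if_neg h] at this
  exact eq_neg_of_add_eq_zero_left this

theorem exists_genC_mul_cPow [Invertible (2 : k)] (p : Fin n) (η : Fin n → ZMod 2) :
    ∃ ε : ℤˣ, genC c Q p * cPow c Q η = ε • cPow c Q (η + Pi.single p 1) :=
  exists_mul_prod_ofFn_pow_of_anticommute _ (genC_mul_self c Q)
    (fun _ _ h => genC_mul_genC_of_ne c Q h) η p

theorem exists_genC_mul_yPow (p : Fin n) (a : Fin n → ℕ) :
    ∃ ε : ℤˣ, genC c Q p * yPow c Q a = ε • (yPow c Q a * genC c Q p) := by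
  refine exists_mul_list_prod _ _ fun q => exists_mul_pow_eq ?_ _
  rw [genC_mul_genY]
  split_ifs
  · exact ⟨-1, by simp⟩
  · exact ⟨1, by simp⟩

theorem genE_mul_yPow (ν : Fin n → J) (a : Fin n → ℕ) :
    genE c Q ν * yPow c Q a = yPow c Q a * genE c Q ν := by
  refine Commute.list_prod_right _ _ fun x hx => ?_
  obtain ⟨p, rfl⟩ := List.mem_ofFn.1 hx
  exact Commute.pow_right (genY_mul_genE c Q p ν).symm _

theorem genE_mul_genC (hc : Function.Involutive c) (p : Fin n) (ν : Fin n → J) :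
    genE c Q ν * genC c Q p = genC c Q p * genE c Q (Function.update ν p (c (ν p))) := by
  rw [genC_mul_genE]
  simp [hc (ν p)]

theorem exists_genE_mul_cPow (hc : Function.Involutive c) (ν : Fin n → J)
    (η : Fin n → ZMod 2) :
    ∃ ν', genE c Q ν * cPow c Q η = cPow c Q η * genE c Q ν' := by
  refine exists_mul_list_prod_eq_mul (genE c Q) _ (fun x hx i => ?_) ν
  obtain ⟨p, rfl⟩ := List.mem_ofFn.1 hx
  clear hx
  generalize (η p).val = m
  induction m generalizing i with
  | zero => exact ⟨i, by simp⟩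
  | succ m ih =>
    obtain ⟨j, hj⟩ := ih i
    exact ⟨_, by rw [pow_succ, ← mul_assoc, hj, mul_assoc, genE_mul_genC c Q hc, ← mul_assoc]⟩

theorem genE_mul_sWord (l : List (Fin (n - 1))) (ν : Fin n → J) :
    ∃ ν', genE c Q ν * sWord c Q l = sWord c Q l * genE c Q ν' := by
  refine exists_mul_list_prod_eq_mul (genE c Q) _ (fun x hx i => ?_) ν
  obtain ⟨a, -, rfl⟩ := List.mem_map.1 hx
  refine ⟨i ∘ simpleTransp a, ?_⟩
  rw [genS_mul_genE]
  congr 2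
  ext p
  simp

/-- The span contains `1` and is stable under left multiplication by each generator of `baseAlg`. -/
theorem baseAlg_le_span [Invertible (2 : k)] (hc : Function.Involutive c) {x : RC n c Q}
    (hx : x ∈ baseAlg c Q n) :
    x ∈ Submodule.span k (Set.range fun t : (Fin n → ℕ) × (Fin n → ZMod 2) × (Fin n → J) =>
      yPow c Q t.1 * cPow c Q t.2.1 * genE c Q t.2.2) := by
  set T := Submodule.span k (Set.range fun t : (Fin n → ℕ) × (Fin n → ZMod 2) × (Fin n → J) =>
      yPow c Q t.1 * cPow c Q t.2.1 * genE c Q t.2.2) with hT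
  have hmem : ∀ a η ν, yPow c Q a * cPow c Q η * genE c Q ν ∈ T := fun a η ν =>
    Submodule.subset_span ⟨(a, η, ν), rfl⟩
  have hsmul : ∀ (ε : ℤˣ) (z : RC n c Q), z ∈ T → ε • z ∈ T := by
    intro ε z hz
    rcases Int.units_eq_one_or ε with rfl | rfl
    · rwa [one_smul]
    · rw [Units.neg_smul, one_smul]
      exact neg_mem hz
  have hone : (1 : RC n c Q) ∈ T := by
    rw [← sum_genE c Q]
    refine sum_mem fun ν _ => ?_
    have := hmem 0 0 ν
    simpa [yPow, cPow] using this
  have key : ∀ x ∈ baseAlg c Q n, ∀ z ∈ T, x * z ∈ T := by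
    intro x hx
    induction hx using Algebra.adjoin_induction with
    | mem x hx =>
      intro z hz
      induction hz using Submodule.span_induction with
      | mem z hz =>
        obtain ⟨⟨a, η, ν⟩, rfl⟩ := hz
        dsimp only
        rcases hx with (⟨p, rfl⟩ | ⟨p, rfl⟩) | ⟨μ, rfl⟩
        · rw [← mul_assoc, ← mul_assoc, genY_mul_yPow]
          exact hmem _ _ _
        · obtain ⟨ε, hε⟩ := exists_genC_mul_yPow c Q p a
          obtain ⟨δ, hδ⟩ := exists_genC_mul_cPow c Q p η
          rw [← mul_assoc, ← mul_assoc, hε, smul_mul_assoc, smul_mul_assoc, mul_assoc (yPow _ _ _),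
            hδ, mul_smul_comm, smul_mul_assoc]
          exact hsmul _ _ (hsmul _ _ (hmem _ _ _))
        · obtain ⟨ν', hν'⟩ := exists_genE_mul_cPow c Q hc μ η
          rw [← mul_assoc, ← mul_assoc, genE_mul_yPow, mul_assoc (yPow _ _ _), hν', ← mul_assoc,
            mul_assoc, genE_mul_genE]
          split_ifs
          · exact hmem _ _ _
          · rw [mul_zero]; exact zero_mem _
      | zero => rw [mul_zero]; exact zero_mem _
      | add z z' _ _ h h' => rw [mul_add]; exact add_mem h h'
      | smul r z _ h => rw [mul_smul_comm]; exact Submodule.smul_mem _ _ h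
    | algebraMap r =>
      intro z hz
      rw [← Algebra.smul_def]
      exact Submodule.smul_mem _ _ hz
    | add x x' _ _ h h' =>
      intro z hz
      rw [add_mul]
      exact add_mem (h z hz) (h' z hz)
    | mul x x' _ _ h h' =>
      intro z hz
      rw [mul_assoc]
      exact h _ (h' z hz)
  simpa using key x hx 1 hone

theorem span_eq_top [Invertible (2 : k)] (hc : Function.Involutive c)
    (word : Equiv.Perm (Fin n) → List (Fin (n - 1))) (hword : ∀ w, IsReducedExpr w (word w)) :
    Submodule.span k (Set.range
      fun t : (Fin n → ℕ) × (Fin n → ZMod 2) × Equiv.Perm (Fin n) × (Fin n → J) =>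
        yPow c Q t.1 * cPow c Q t.2.1 * sWord c Q (word t.2.2.1) * genE c Q t.2.2.2) = ⊤ := by
  set S := Submodule.span k (Set.range
      fun t : (Fin n → ℕ) × (Fin n → ZMod 2) × Equiv.Perm (Fin n) × (Fin n → J) =>
        yPow c Q t.1 * cPow c Q t.2.1 * sWord c Q (word t.2.2.1) * genE c Q t.2.2.2) with hS
  -- Base monomials end in an `e(ν)`, which is carried across the `σ`'s to the far right.
  have hred : ∀ x ∈ baseAlg c Q n, ∀ w, x * sWord c Q (word w) ∈ S := by
    intro x hx w
    replace hx := baseAlg_le_span c Q hc hx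
    induction hx using Submodule.span_induction with
    | mem x hx =>
      obtain ⟨⟨a, η, ν⟩, rfl⟩ := hx
      obtain ⟨ν', hν'⟩ := genE_mul_sWord c Q (word w) ν
      dsimp only
      rw [mul_assoc, hν', ← mul_assoc]
      exact Submodule.subset_span ⟨(a, η, w, ν'), rfl⟩
    | zero => rw [zero_mul]; exact zero_mem _
    | add z z' _ _ h h' => rw [add_mul]; exact add_mem h h'
    | smul r z _ h => rw [smul_mul_assoc]; exact Submodule.smul_mem _ _ h
  have key : ∀ m, filt c Q n m ≤ S := by
    intro m
    induction m with
    -- No word has length below `0`, so the filtration starts at the zero submodule.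
    | zero =>
      refine Submodule.span_le.2 ?_
      rintro _ ⟨x, hx, l, hl, rfl⟩
      exact absurd hl (Nat.not_lt_zero _)
    | succ m ih =>
      refine Submodule.span_le.2 ?_
      rintro _ ⟨x, hx, l, hl, rfl⟩
      rcases (Nat.lt_succ_iff.1 hl).lt_or_eq with hlt | heq
      · exact ih (mul_sWord_mem_filt c Q hx hlt)
      · subst heq
        rcases (invCount_wordProd_le l).lt_or_eq with h | h
        · exact ih (mul_mem_filt c Q hx (sWord_mem_filt_of_not_reduced c Q l h))
        · have hw := hword (wordProd l)
          have d := mul_mem_filt c Q hx (sWord_sub_mem_filt c Q l (word (wordProd l)) rfl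
            (hw.length_eq.trans h) hw.1.symm h)
          rw [mul_sub] at d
          have := add_mem (ih d) (hred x hx (wordProd l))
          rwa [sub_add_cancel] at this
  rw [eq_top_iff]
  intro z _
  obtain ⟨m, hm⟩ := exists_mem_filt c Q z
  exact key m hm

end RC

end Spanning

/-! ### The symmetries of the polynomials `Q`, evaluated at ring elements. -/

section DatumEval

variable {k K J : Type*} [CommRing k] [CommRing K] [Algebra k K] {c : J → J}
  {Q : J → J → MvPolynomial (Fin 2) k}

theorem aeval_aeval_pair (P p q : MvPolynomial (Fin 2) k) (u v : K) :
    MvPolynomial.aeval ![u, v] (MvPolynomial.aeval ![p, q] P) =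
      MvPolynomial.aeval ![MvPolynomial.aeval ![u, v] p, MvPolynomial.aeval ![u, v] q] P := by
  rw [MvPolynomial.comp_aeval_apply]
  congr 2
  ext i
  fin_cases i <;> rfl

theorem IsDatum.aeval_symm (hQ : IsDatum c Q) (i j : J) (u v : K) :
    MvPolynomial.aeval ![u, v] (Q j i) = MvPolynomial.aeval ![v, u] (Q i j) := by
  rw [hQ.symm i j, aeval_aeval_pair]
  simp

theorem IsDatum.aeval_neg_left (hQ : IsDatum c Q) (i j : J) (u v : K) :
    MvPolynomial.aeval ![-u, v] (Q (c i) j) = MvPolynomial.aeval ![u, v] (Q i j) := by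
  conv_rhs => rw [← hQ.neg_left i j, aeval_aeval_pair]
  simp

theorem IsDatum.aeval_neg_right (hQ : IsDatum c Q) (i j : J) (u v : K) :
    MvPolynomial.aeval ![u, -v] (Q i (c j)) = MvPolynomial.aeval ![u, v] (Q i j) := by
  conv_rhs => rw [← hQ.neg_right i j, aeval_aeval_pair]
  simp

end DatumEval

/-! ### Slots and positions, and the scalar coefficients of the representation. -/

section Weights

variable {n : ℕ} {J : Type*}

/-- The index set of a basis of the principal series modules: a permutation, a sign vector and
a sequence of colours. -/
abbrev WtIndex (n : ℕ) (J : Type*) := Equiv.Perm (Fin n) × (Fin n → ZMod 2) × (Fin n → J)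

/-- Changing the sign at position `p`. -/
def flipAt (p : Fin n) (x : WtIndex n J) : WtIndex n J :=
  (x.1, x.2.1 + Pi.single (x.1⁻¹ p) 1, x.2.2)

/-- Exchanging the positions `a` and `a + 1`. -/
def reflAt (a : Fin (n - 1)) (x : WtIndex n J) : WtIndex n J := (simpleTransp a * x.1, x.2)

/-- The colour at position `p`. -/
def colour (c : J → J) (x : WtIndex n J) (p : Fin n) : J :=
  if x.2.1 (x.1⁻¹ p) = 0 then x.2.2 (x.1⁻¹ p) else c (x.2.2 (x.1⁻¹ p))

/-- The sign `(-1) ^ i`. -/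
def signOf (K : Type*) [CommRing K] (i : ZMod 2) : K := if i = 0 then 1 else -1

theorem signOf_add_one (K : Type*) [CommRing K] (i : ZMod 2) :
    signOf K (i + 1) = -signOf K i := by
  rcases (by decide : ∀ i : ZMod 2, i = 0 ∨ i = 1) i with rfl | rfl
  · simp [signOf]
  · have h : (1 + 1 : ZMod 2) = 0 := by decide
    simp [signOf, h]

theorem signOf_mul_self (K : Type*) [CommRing K] (i : ZMod 2) :
    signOf K i * signOf K i = 1 := by
  unfold signOf
  split_ifs <;> simp

theorem flipAt_flipAt (p : Fin n) (x : WtIndex n J) : flipAt p (flipAt p x) = x := by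
  have h : (1 + 1 : ZMod 2) = 0 := by decide
  simp only [flipAt, add_assoc, ← Pi.single_add, h, Pi.single_zero, add_zero]

theorem flipAt_comm (p q : Fin n) (x : WtIndex n J) :
    flipAt p (flipAt q x) = flipAt q (flipAt p x) := by
  simp only [flipAt, add_right_comm]

theorem reflAt_reflAt (a : Fin (n - 1)) (x : WtIndex n J) : reflAt a (reflAt a x) = x := by
  simp [reflAt]

theorem reflAt_flipAt (a : Fin (n - 1)) (p : Fin n) (x : WtIndex n J) :
    reflAt a (flipAt p x) = flipAt (simpleTransp a p) (reflAt a x) := by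
  simp only [reflAt, flipAt, inv_simpleTransp_mul_apply, simpleTransp_apply_self]

theorem flipAt_sign_same (p : Fin n) (x : WtIndex n J) :
    (flipAt p x).2.1 ((flipAt p x).1⁻¹ p) = x.2.1 (x.1⁻¹ p) + 1 := by
  simp [flipAt]

theorem flipAt_sign_of_ne {p q : Fin n} (h : q ≠ p) (x : WtIndex n J) :
    (flipAt p x).2.1 ((flipAt p x).1⁻¹ q) = x.2.1 (x.1⁻¹ q) := by
  have : x.1⁻¹ q ≠ x.1⁻¹ p := fun h' => h (x.1⁻¹.injective h')
  simp only [flipAt, Pi.add_apply, Pi.single_eq_of_ne this, add_zero]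

theorem colour_flipAt_same {c : J → J} (hc : Function.Involutive c) (p : Fin n)
    (x : WtIndex n J) : colour c (flipAt p x) p = c (colour c x p) := by
  rw [colour, flipAt_sign_same, colour]
  have h : (1 + 1 : ZMod 2) = 0 := by decide
  rcases (by decide : ∀ i : ZMod 2, i = 0 ∨ i = 1) (x.2.1 (x.1⁻¹ p)) with h' | h' <;>
    simp only [h', h] <;> simp [flipAt, hc _]

theorem colour_flipAt_of_ne (c : J → J) {p q : Fin n} (h : q ≠ p)
    (x : WtIndex n J) : colour c (flipAt p x) q = colour c x q := by
  rw [colour, flipAt_sign_of_ne h, colour]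
  rfl

theorem colour_flipAt {c : J → J} (hc : Function.Involutive c) (p : Fin n)
    (x : WtIndex n J) : colour c (flipAt p x)
      = Function.update (colour c x) p (c (colour c x p)) := by
  ext q
  by_cases h : q = p
  · subst h
    rw [colour_flipAt_same hc, Function.update_self]
  · rw [colour_flipAt_of_ne c h, Function.update_of_ne h]

theorem colour_reflAt (c : J → J) (a : Fin (n - 1)) (x : WtIndex n J) (p : Fin n) :
    colour c (reflAt a x) p = colour c x (simpleTransp a p) := by
  simp only [colour, reflAt, inv_simpleTransp_mul_apply]

variable {K : Type*} [CommRing K] (y : Fin n → K)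

/-- The eigenvalue of `y_p`. -/
def wtY (p : Fin n) (x : WtIndex n J) : K := signOf K (x.2.1 (x.1⁻¹ p)) * y (x.1⁻¹ p)

theorem wtY_flipAt_same (p : Fin n) (x : WtIndex n J) :
    wtY y p (flipAt p x) = -wtY y p x := by
  rw [wtY, flipAt_sign_same, signOf_add_one, neg_mul]
  rfl

theorem wtY_flipAt_of_ne {p q : Fin n} (h : q ≠ p) (x : WtIndex n J) :
    wtY y q (flipAt p x) = wtY y q x := by
  rw [wtY, flipAt_sign_of_ne h]
  rfl

theorem wtY_reflAt (a : Fin (n - 1)) (p : Fin n) (x : WtIndex n J) :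
    wtY y p (reflAt a x) = wtY y (simpleTransp a p) x := by
  simp only [wtY, reflAt, inv_simpleTransp_mul_apply]

/-- All `y_i - y_j` and `y_i + y_j` with `i ≠ j` are invertible. -/
def IsGeneric : Prop := ∀ i j, i ≠ j → IsUnit (y i - y j) ∧ IsUnit (y i + y j)

variable {y}

theorem IsGeneric.isUnit_wtY (hy : IsGeneric y) {i j : Fin n} (h : i ≠ j) (x : WtIndex n J) :
    IsUnit (wtY y j x - wtY y i x) ∧ IsUnit (wtY y i x + wtY y j x) := by
  have h' : x.1⁻¹ i ≠ x.1⁻¹ j := fun h' => h (x.1⁻¹.injective h')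
  obtain ⟨h1, h2⟩ := hy _ _ h'
  unfold wtY signOf
  split_ifs
  · exact ⟨by convert h1.neg using 1; ring, by convert h2 using 1; ring⟩
  · exact ⟨by convert h2 using 1; ring, by convert h1.neg using 1; ring⟩
  · exact ⟨by convert h2.neg using 1; ring, by convert h1 using 1; ring⟩
  · exact ⟨by convert h1 using 1; ring, by convert h2.neg using 1; ring⟩

/-- Partial fractions: `1/(uv) + 1/(vw) = (u + w)/(uvw)`. This is the scalar core of the Yang-Baxter
equation. -/
theorem inverse_mul_identity {u v w : K} (hu : IsUnit u) (hv : IsUnit v) (hw : IsUnit w)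
    (h : v = u + w) :
    Ring.inverse u * Ring.inverse v + Ring.inverse v * Ring.inverse w
      = Ring.inverse w * Ring.inverse u := by
  have h1 := Ring.mul_inverse_cancel u hu
  have h2 := Ring.mul_inverse_cancel v hv
  have h3 := Ring.mul_inverse_cancel w hw
  linear_combination (-(Ring.inverse u * Ring.inverse v)) * h3
    - Ring.inverse v * Ring.inverse w * h1 + Ring.inverse w * Ring.inverse u * h2
    - Ring.inverse u * Ring.inverse v * Ring.inverse w * h

/-- Any two of the colour conditions imply the third, so either all of them hold or every product
vanishes. -/
theorem ite_mul_identity {A B C : Prop} [Decidable A] [Decidable B] [Decidable C] {u v w : K}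
    (hC : A → B → C) (hA : B → C → A) (hB : A → C → B) (h : u * v + v * w = w * u) :
    (if A then u else 0) * (if B then v else 0) + (if B then v else 0) * (if C then w else 0)
      = (if C then w else 0) * (if A then u else 0) := by
  by_cases a : A <;> by_cases b : B <;> by_cases c : C <;> simp_all

theorem inverse_neg_eq (u : K) : Ring.inverse (-u) = -Ring.inverse u := by
  by_cases hu : IsUnit u
  · have h1 := Ring.mul_inverse_cancel u hu
    have h2 := Ring.mul_inverse_cancel (-u) hu.neg
    linear_combination (-Ring.inverse u) * h2 - Ring.inverse (-u) * h1
  · have hu' : ¬ IsUnit (-u) := fun h => hu (by simpa using h.neg)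
    rw [Ring.inverse_non_unit _ hu, Ring.inverse_non_unit _ hu', neg_zero]

section Polynomial

variable {k : Type*} [CommRing k] [Algebra k K] (y) (c : J → J)
  (Q : J → J → MvPolynomial (Fin 2) k)

/-- The value of `Q` at the colours and eigenvalues at `i` and `j`. -/
noncomputable def coefQ (i j : Fin n) (x : WtIndex n J) : K :=
  MvPolynomial.aeval ![wtY y i x, wtY y j x] (Q (colour c x i) (colour c x j))

variable {c Q}

/-- A flip negates an eigenvalue and applies `c` to the colour; the parity conditions on `Q` make
the two effects cancel. -/
theorem coefQ_flipAt (hQ : IsDatum c Q) {i j : Fin n} (h : i ≠ j) (p : Fin n)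
    (x : WtIndex n J) : coefQ y c Q i j (flipAt p x) = coefQ y c Q i j x := by
  rw [coefQ, coefQ]
  by_cases hi : i = p
  · subst hi
    rw [wtY_flipAt_same, colour_flipAt_same hQ.involutive, wtY_flipAt_of_ne y h.symm,
      colour_flipAt_of_ne c h.symm, hQ.aeval_neg_left]
  · rw [wtY_flipAt_of_ne y hi, colour_flipAt_of_ne c hi]
    by_cases hj : j = p
    · subst hj
      rw [wtY_flipAt_same, colour_flipAt_same hQ.involutive, hQ.aeval_neg_right]
    · rw [wtY_flipAt_of_ne y hj, colour_flipAt_of_ne c hj]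

end Polynomial

variable [DecidableEq J] (c : J → J) (y)

/-- `(y_j - y_i)⁻¹` where the colours at `i` and `j` agree. -/
noncomputable def coefA (i j : Fin n) (x : WtIndex n J) : K :=
  if colour c x i = colour c x j then Ring.inverse (wtY y j x - wtY y i x) else 0

/-- `(y_i + y_j)⁻¹` where the colours at `i` and `j` are exchanged by `c`. -/
noncomputable def coefB (i j : Fin n) (x : WtIndex n J) : K :=
  if colour c x i = c (colour c x j) then Ring.inverse (wtY y i x + wtY y j x) else 0

variable {c}

/-- Replacing `y_i` by `-y_i` and the colour at `i` by its image under `c` exchanges both the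
denominators and the colour conditions of `coefA` and `coefB`. -/
theorem coefA_flipAt_left (hc : Function.Involutive c) {i j : Fin n} (h : i ≠ j)
    (x : WtIndex n J) : coefA y c i j (flipAt i x) = coefB y c i j x := by
  rw [coefA, coefB, colour_flipAt_same hc, colour_flipAt_of_ne c h.symm, wtY_flipAt_same,
    wtY_flipAt_of_ne y h.symm, sub_neg_eq_add, add_comm]
  simp only [hc.eq_iff]

theorem coefB_flipAt_left (hc : Function.Involutive c) {i j : Fin n} (h : i ≠ j)
    (x : WtIndex n J) : coefB y c i j (flipAt i x) = coefA y c i j x := by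
  rw [← coefA_flipAt_left y hc h, flipAt_flipAt]

theorem coefA_flipAt_right (hc : Function.Involutive c) {i j : Fin n} (h : i ≠ j)
    (x : WtIndex n J) : coefA y c i j (flipAt j x) = -coefB y c i j x := by
  rw [coefA, coefB, colour_flipAt_same hc, colour_flipAt_of_ne c h, wtY_flipAt_same,
    wtY_flipAt_of_ne y h, ← neg_add', inverse_neg_eq, add_comm (wtY y j x)]
  split_ifs <;> simp

theorem coefB_flipAt_right (hc : Function.Involutive c) {i j : Fin n} (h : i ≠ j)
    (x : WtIndex n J) : coefB y c i j (flipAt j x) = -coefA y c i j x := by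
  have := coefA_flipAt_right y hc h (flipAt j x)
  rw [flipAt_flipAt] at this
  rw [this, neg_neg]

theorem coefA_flipAt_of_ne {i j p : Fin n} (hi : i ≠ p) (hj : j ≠ p)
    (x : WtIndex n J) : coefA y c i j (flipAt p x) = coefA y c i j x := by
  rw [coefA, coefA, colour_flipAt_of_ne c hi, colour_flipAt_of_ne c hj,
    wtY_flipAt_of_ne y hi, wtY_flipAt_of_ne y hj]

theorem coefB_flipAt_of_ne {i j p : Fin n} (hi : i ≠ p) (hj : j ≠ p)
    (x : WtIndex n J) : coefB y c i j (flipAt p x) = coefB y c i j x := by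
  rw [coefB, coefB, colour_flipAt_of_ne c hi, colour_flipAt_of_ne c hj,
    wtY_flipAt_of_ne y hi, wtY_flipAt_of_ne y hj]

theorem coefA_reflAt (a : Fin (n - 1)) (i j : Fin n) (x : WtIndex n J) :
    coefA y c i j (reflAt a x) = coefA y c (simpleTransp a i) (simpleTransp a j) x := by
  rw [coefA, coefA, colour_reflAt, colour_reflAt, wtY_reflAt, wtY_reflAt]

theorem coefB_reflAt (a : Fin (n - 1)) (i j : Fin n) (x : WtIndex n J) :
    coefB y c i j (reflAt a x) = coefB y c (simpleTransp a i) (simpleTransp a j) x := by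
  rw [coefB, coefB, colour_reflAt, colour_reflAt, wtY_reflAt, wtY_reflAt]

theorem coefA_swap (i j : Fin n) (x : WtIndex n J) :
    coefA y c j i x = -coefA y c i j x := by
  rw [coefA, coefA, ← neg_sub, inverse_neg_eq]
  simp only [eq_comm (a := colour c x j)]
  split_ifs <;> simp

theorem coefB_swap (hc : Function.Involutive c) (i j : Fin n) (x : WtIndex n J) :
    coefB y c j i x = coefB y c i j x := by
  rw [coefB, coefB, add_comm]
  simp only [← hc.eq_iff (x := colour c x j), eq_comm (a := c (colour c x j))]

variable {y}

/-- This identity and the next three are the coefficients of `1`, `c_i c_j`, `c_i c_l`, `c_j c_l` in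
the Yang-Baxter equation for `rOp`. -/
theorem coefA_coefA_identity (hy : IsGeneric y) {i j l : Fin n} (hij : i ≠ j) (hil : i ≠ l)
    (hjl : j ≠ l) (x : WtIndex n J) :
    coefA y c i j x * coefA y c i l x + coefA y c i l x * coefA y c j l x
      = coefA y c j l x * coefA y c i j x := by
  refine ite_mul_identity ?_ ?_ ?_ (inverse_mul_identity (hy.isUnit_wtY hij x).1
    (hy.isUnit_wtY hil x).1 (hy.isUnit_wtY hjl x).1 (by ring))
  · exact fun h h' => h.symm.trans h'
  · exact fun h h' => h.trans h'.symm
  · exact fun h h' => h.trans h'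

theorem coefB_coefB_identity (hc : Function.Involutive c) (hy : IsGeneric y) {i j l : Fin n}
    (hij : i ≠ j) (hil : i ≠ l) (hjl : j ≠ l) (x : WtIndex n J) :
    coefB y c i j x * coefB y c i l x + coefB y c i l x * coefA y c j l x
      = coefA y c j l x * coefB y c i j x := by
  refine ite_mul_identity ?_ ?_ ?_ (inverse_mul_identity (hy.isUnit_wtY hij x).2
    (hy.isUnit_wtY hil x).2 (hy.isUnit_wtY hjl x).1 (by ring))
  · exact fun h h' => hc.injective (h.symm.trans h')
  · exact fun h h' => h.trans (congrArg c h'.symm)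
  · exact fun h h' => h.trans (congrArg c h')

theorem coefA_coefB_identity (hy : IsGeneric y) {i j l : Fin n}
    (hij : i ≠ j) (hil : i ≠ l) (hjl : j ≠ l) (x : WtIndex n J) :
    coefA y c i j x * coefB y c j l x + coefB y c j l x * coefB y c i l x
      = coefB y c i l x * coefA y c i j x := by
  refine ite_mul_identity ?_ ?_ ?_ (inverse_mul_identity (hy.isUnit_wtY hij x).1
    (hy.isUnit_wtY hjl x).2 (hy.isUnit_wtY hil x).2 (by ring))
  · exact fun h h' => h.trans h'
  · exact fun h h' => h'.trans h.symm
  · exact fun h h' => h.symm.trans h'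

theorem coefB_coefA_identity (hc : Function.Involutive c) (hy : IsGeneric y) {i j l : Fin n}
    (hij : i ≠ j) (hil : i ≠ l) (hjl : j ≠ l) (x : WtIndex n J) :
    coefB y c i j x * coefB y c j l x + coefB y c j l x * coefA y c i l x
      = coefA y c i l x * coefB y c i j x := by
  refine ite_mul_identity ?_ ?_ ?_ (inverse_mul_identity (hy.isUnit_wtY hij x).2
    (hy.isUnit_wtY hjl x).2 (hy.isUnit_wtY hil x).1 (by ring))
  · exact fun h h' => h.trans (hc.eq_iff.2 h')
  · exact fun h h' => h'.trans (hc.eq_iff.2 h).symm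
  · exact fun h h' => hc.eq_iff.1 (h.symm.trans h')

section Quadratic

variable {k : Type*} [CommRing k] [Algebra k K] {Q : J → J → MvPolynomial (Fin 2) k}

variable (y c Q)

/-- The square of the intertwiner exchanging the positions `i` and `j`. -/
noncomputable def coefN (i j : Fin n) (x : WtIndex n J) : K :=
  coefQ y c Q i j x - coefA y c i j x ^ 2 - coefB y c i j x ^ 2

/-- The factor `coefN` where `x⁻¹` does not reverse the order of `i` and `j`, `1` elsewhere. -/
noncomputable def coefK (i j : Fin n) (x : WtIndex n J) : K :=
  if x.1⁻¹ i < x.1⁻¹ j then coefN y c Q i j x else 1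

variable {c Q}

theorem sq_add_sq_flipAt (hc : Function.Involutive c) {i j : Fin n} (h : i ≠ j) (p : Fin n)
    (x : WtIndex n J) :
    coefA y c i j (flipAt p x) ^ 2 + coefB y c i j (flipAt p x) ^ 2
      = coefA y c i j x ^ 2 + coefB y c i j x ^ 2 := by
  by_cases hi : i = p
  · subst hi
    rw [coefA_flipAt_left y hc h, coefB_flipAt_left y hc h, add_comm]
  · by_cases hj : j = p
    · subst hj
      rw [coefA_flipAt_right y hc h, coefB_flipAt_right y hc h, neg_sq, neg_sq, add_comm]
    · rw [coefA_flipAt_of_ne y hi hj, coefB_flipAt_of_ne y hi hj]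

theorem coefN_flipAt (hQ : IsDatum c Q) {i j : Fin n} (h : i ≠ j) (p : Fin n)
    (x : WtIndex n J) : coefN y c Q i j (flipAt p x) = coefN y c Q i j x := by
  rw [coefN, coefN, coefQ_flipAt y hQ h, sub_sub, sq_add_sq_flipAt y hQ.involutive h, sub_sub]

theorem coefK_flipAt (hQ : IsDatum c Q) {i j : Fin n} (h : i ≠ j) (p : Fin n)
    (x : WtIndex n J) : coefK y c Q i j (flipAt p x) = coefK y c Q i j x := by
  rw [coefK, coefN_flipAt y hQ h]
  rfl

theorem coefN_reflAt (a : Fin (n - 1)) (i j : Fin n) (x : WtIndex n J) :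
    coefN y c Q i j (reflAt a x) = coefN y c Q (simpleTransp a i) (simpleTransp a j) x := by
  rw [coefN, coefN, coefA_reflAt, coefB_reflAt, coefQ, coefQ, colour_reflAt, colour_reflAt,
    wtY_reflAt, wtY_reflAt]

theorem coefK_reflAt (a : Fin (n - 1)) (i j : Fin n) (x : WtIndex n J) :
    coefK y c Q i j (reflAt a x) = coefK y c Q (simpleTransp a i) (simpleTransp a j) x := by
  rw [coefK, coefN_reflAt, coefK]
  simp only [reflAt, inv_simpleTransp_mul_apply]

theorem coefN_swap (hQ : IsDatum c Q) (i j : Fin n) (x : WtIndex n J) :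
    coefN y c Q j i x = coefN y c Q i j x := by
  rw [coefN, coefN, coefA_swap, coefB_swap y hQ.involutive, neg_sq, coefQ, coefQ,
    hQ.aeval_symm]

/-- `coefN` is symmetric in `i` and `j`, and exactly one of the two orderings carries it as a
factor. This lets the intertwiner have square `coefN` without extracting a root. -/
theorem coefK_mul_coefK_swap (hQ : IsDatum c Q) {i j : Fin n} (h : i ≠ j) (x : WtIndex n J) :
    coefK y c Q i j x * coefK y c Q j i x = coefN y c Q i j x := by
  have h' : x.1⁻¹ i ≠ x.1⁻¹ j := fun h' => h (x.1⁻¹.injective h')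
  rw [coefK, coefK]
  rcases lt_or_gt_of_ne h' with h1 | h1
  · rw [if_pos h1, if_neg h1.not_gt, mul_one]
  · rw [if_neg h1.not_gt, if_pos h1, one_mul, coefN_swap y hQ]

end Quadratic

end Weights

/-! ### The Yang-Baxter and deformed braid identities in an arbitrary ring. -/

section RingIdentities

variable {R : Type*} [Ring R]

/-- The classical Yang-Baxter equation for elements `a + b p`, where `p`, `r`, `s` stand for the
products of two out of three Clifford generators. -/
theorem yangBaxter_of_coef {a₁ b₁ a₂ b₂ a₃ b₃ p r s : R}
    (hpr : p * r = -s) (hrs : r * s = -p) (hsp : s * p = -r)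
    (hpa : p * a₂ = b₂ * p) (hpb : p * b₂ = a₂ * p)
    (hra : r * a₃ = -(b₃ * r)) (hrb : r * b₃ = -(a₃ * r))
    (hsa : s * a₁ = -(b₁ * s)) (hsb : s * b₁ = -(a₁ * s))
    (h₁ : a₁ * a₂ + a₂ * a₃ = a₃ * a₁) (h₂ : b₁ * b₂ + b₂ * a₃ = a₃ * b₁)
    (h₃ : a₁ * b₂ - b₂ * b₃ = b₃ * a₁) (h₄ : a₂ * b₃ - b₁ * a₂ = -(b₃ * b₁)) :
    (a₁ + b₁ * p) * (a₂ + b₂ * r) + (a₂ + b₂ * r) * (a₃ + b₃ * s)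
      = (a₃ + b₃ * s) * (a₁ + b₁ * p) := by
  -- Once `p`, `r`, `s` stand to the right of all coefficients, `h₁`, …, `h₄` compare the
  -- coefficients of `1`, `p`, `r`, `s`.
  have e1 : b₁ * p * a₂ = b₁ * b₂ * p := by rw [mul_assoc, hpa, mul_assoc]
  have e2 : b₁ * p * (b₂ * r) = -(b₁ * a₂ * s) := by
    rw [mul_assoc, ← mul_assoc p, hpb, mul_assoc, hpr]; noncomm_ring
  have e3 : b₂ * r * a₃ = -(b₂ * b₃ * r) := by rw [mul_assoc, hra]; noncomm_ring
  have e4 : b₂ * r * (b₃ * s) = b₂ * a₃ * p := by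
    rw [mul_assoc, ← mul_assoc r, hrb, neg_mul, mul_assoc, hrs]; noncomm_ring
  have e5 : b₃ * s * a₁ = -(b₃ * b₁ * s) := by rw [mul_assoc, hsa]; noncomm_ring
  have e6 : b₃ * s * (b₁ * p) = b₃ * a₁ * r := by
    rw [mul_assoc, ← mul_assoc s, hsb, neg_mul, mul_assoc, hsp]; noncomm_ring
  have e : (a₁ + b₁ * p) * (a₂ + b₂ * r) + (a₂ + b₂ * r) * (a₃ + b₃ * s)
      = (a₁ * a₂ + a₂ * a₃) + (b₁ * b₂ + b₂ * a₃) * p + (a₁ * b₂ - b₂ * b₃) * r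
        + (a₂ * b₃ - b₁ * a₂) * s := by
    simp only [add_mul, mul_add, e1, e2, e3, e4]
    noncomm_ring
  rw [e, h₁, h₂, h₃, h₄]
  simp only [add_mul, mul_add, e5, e6]
  noncomm_ring

/-- The deformed braid relation for `x + a` and `z + b`, where `a` and `b` are braided
intertwiners. -/
theorem braid_of_yangBaxter {a b x t z q q' : R} (hbr : a * b * a = b * a * b)
    (hax : a * x = -(x * a)) (haz : a * z = t * a) (hat : a * t = z * a)
    (hbz : b * z = -(z * b)) (hbx : b * x = t * b) (hbt : b * t = x * b)
    (ha : x * x + a * a = q) (hb : z * z + b * b = q')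
    (hy₁ : x * t + t * z = z * x) (hy₂ : z * t + t * x = x * z)
    (hq : q * t = t * q) (hq' : q' * t = t * q') (hz : z * z * t = t * (z * z)) :
    (z + b) * (x + a) * (z + b) - (x + a) * (z + b) * (x + a) = (q' - q) * t := by
  have ha' : a * a = q - x * x := by rw [← ha]; abel
  have hb' : b * b = q' - z * z := by rw [← hb]; abel
  -- The expansion is sorted by the intertwiners that occur: none or a repeated one in `c0`, a
  -- single `a` or `b` in `ca` and `cb`, both in `cab` and `cba`. Only `c0` contributes; the triple
  -- products cancel by `hbr`.
  have c0 : z * x * z - x * z * x + b * x * b - a * z * a = (q' - q) * t := by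
    have e1 : b * x * b = t * q' - t * (z * z) := by rw [hbx, mul_assoc, hb', mul_sub]
    have e2 : a * z * a = t * q - t * (x * x) := by rw [haz, mul_assoc, ha', mul_sub]
    have e3 : z * x * z = z * z * t + z * t * x := by
      rw [mul_assoc, ← hy₂]; noncomm_ring
    have e4 : x * z * x = z * t * x + t * (x * x) := by
      rw [← hy₂]; noncomm_ring
    rw [e1, e2, e3, e4, hz, sub_mul, hq, hq']
    abel
  have ca : z * a * z - a * z * x - x * z * a = 0 := by
    have e1 : z * a * z = z * t * a := by rw [mul_assoc, haz, mul_assoc]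
    have e2 : a * z * x = -(t * x * a) := by rw [haz, mul_assoc, hax]; noncomm_ring
    rw [e1, e2, ← hy₂]
    noncomm_ring
  have cb : b * x * z + z * x * b - x * b * x = 0 := by
    have e1 : b * x * z = -(t * z * b) := by rw [hbx, mul_assoc, hbz]; noncomm_ring
    have e2 : x * b * x = x * t * b := by rw [mul_assoc, hbx, mul_assoc]
    rw [e1, e2, ← hy₁]
    noncomm_ring
  have cab : z * a * b - a * b * x = 0 := by
    rw [mul_assoc a, hbx, ← mul_assoc a, hat, sub_self]
  have cba : b * a * z - x * b * a = 0 := by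
    rw [mul_assoc b, haz, ← mul_assoc b, hbt, sub_self]
  linear_combination (norm := noncomm_ring) c0 + ca + cb + cab + cba - hbr

end RingIdentities

/-! ### Diagonal operators, Clifford operators and intertwiners. -/

section Operators

variable (k : Type*) [CommRing k] {n : ℕ} {J : Type*} {K : Type*} [CommRing K] [Algebra k K]

/-- The ring of operators on the functions on `WtIndex n J`. -/
def WtEnd (n : ℕ) (J K : Type*) [CommRing K] : Type _ := Module.End K (WtIndex n J → K)

noncomputable instance : Ring (WtEnd n J K) :=
  inferInstanceAs (Ring (Module.End K (WtIndex n J → K)))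

noncomputable instance : Algebra k (WtEnd n J K) :=
  inferInstanceAs (Algebra k (Module.End K (WtIndex n J → K)))

/-- The operation on functions. -/
def WtEnd.app (f : WtEnd n J K) : (WtIndex n J → K) →ₗ[K] (WtIndex n J → K) := f

theorem WtEnd.ext {f g : WtEnd n J K} (h : ∀ m x, f.app m x = g.app m x) : f = g :=
  LinearMap.ext fun m => funext fun x => h m x

@[simp] theorem WtEnd.app_mul (f g : WtEnd n J K) (m : WtIndex n J → K) :
    (f * g).app m = f.app (g.app m) := rfl

@[simp] theorem WtEnd.app_add (f g : WtEnd n J K) (m : WtIndex n J → K) (x : WtIndex n J) :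
    (f + g).app m x = f.app m x + g.app m x := rfl

theorem WtEnd.app_sum {ι : Type*} (s : Finset ι) (f : ι → WtEnd n J K) (m : WtIndex n J → K)
    (x : WtIndex n J) : (∑ i ∈ s, f i).app m x = ∑ i ∈ s, (f i).app m x :=
  map_sum ({ toFun := fun g => g.app m x, map_zero' := rfl, map_add' := fun _ _ => rfl } :
    WtEnd n J K →+ K) f s

@[simp] theorem WtEnd.app_neg (f : WtEnd n J K) (m : WtIndex n J → K) (x : WtIndex n J) :
    (-f).app m x = -f.app m x := rfl

@[simp] theorem WtEnd.app_one (m : WtIndex n J → K) : (1 : WtEnd n J K).app m = m := rfl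

@[simp] theorem WtEnd.app_smul (r : k) (f : WtEnd n J K) (m : WtIndex n J → K)
    (x : WtIndex n J) : (r • f).app m x = r • f.app m x := rfl

/-- Multiplication by a function. -/
noncomputable def diagOp : (WtIndex n J → K) →ₐ[k] WtEnd n J K :=
  (Algebra.lmul K (WtIndex n J → K)).restrictScalars k

@[simp] theorem diagOp_apply (f m : WtIndex n J → K) (x : WtIndex n J) :
    (diagOp k f).app m x = f x * m x := rfl

variable (K)

/-- The Jordan-Wigner sign at position `p`. -/
noncomputable def jwSign (p : Fin n) (x : WtIndex n J) : K :=
  ∏ q ∈ Finset.univ.filter (· < x.1⁻¹ p), signOf K (x.2.1 q)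

/-- The sign is ordered by slots, not by positions, so exchanging two positions creates no extra
sign. Hence the intertwiners permute the `c_p` exactly. -/
theorem jwSign_reflAt (a : Fin (n - 1)) (p : Fin n) (x : WtIndex n J) :
    jwSign K p (reflAt a x) = jwSign K (simpleTransp a p) x := by
  simp only [jwSign, reflAt, inv_simpleTransp_mul_apply]

theorem jwSign_mul_self (p : Fin n) (x : WtIndex n J) : jwSign K p x * jwSign K p x = 1 := by
  rw [jwSign, ← Finset.prod_mul_distrib]
  exact Finset.prod_eq_one fun q _ => signOf_mul_self K _

theorem jwSign_flipAt_of_le {p q : Fin n} (x : WtIndex n J) (h : x.1⁻¹ q ≤ x.1⁻¹ p) :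
    jwSign K q (flipAt p x) = jwSign K q x := by
  refine Finset.prod_congr rfl fun i hi => ?_
  have hne : i ≠ x.1⁻¹ p := by
    have hi : i < x.1⁻¹ q := by simpa [flipAt] using hi
    exact (hi.trans_le h).ne
  simp only [flipAt, Pi.add_apply, Pi.single_eq_of_ne hne, add_zero]

theorem jwSign_flipAt_of_lt {p q : Fin n} (x : WtIndex n J) (h : x.1⁻¹ p < x.1⁻¹ q) :
    jwSign K q (flipAt p x) = -jwSign K q x := by
  have hmem : x.1⁻¹ p ∈ Finset.univ.filter (· < x.1⁻¹ q) := by simpa using h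
  have e : jwSign K q (flipAt p x) = ∏ i ∈ Finset.univ.filter (· < x.1⁻¹ q),
      signOf K ((x.2.1 + Pi.single (x.1⁻¹ p) 1 : Fin n → ZMod 2) i) := rfl
  rw [e, jwSign, ← Finset.mul_prod_erase _ _ hmem, ← Finset.mul_prod_erase _ _ hmem, ← neg_mul]
  congr 1
  · simp only [Pi.add_apply, Pi.single_eq_same, signOf_add_one]
  · refine Finset.prod_congr rfl fun i hi => ?_
    rw [Pi.add_apply, Pi.single_eq_of_ne (Finset.ne_of_mem_erase hi), add_zero]

/-- The operator of `c_p`. -/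
noncomputable def cliffOp (p : Fin n) : WtEnd n J K :=
  show Module.End K (WtIndex n J → K) from {
    toFun := fun m x => jwSign K p x * m (flipAt p x)
    map_add' := fun m m' => by ext x; simp [mul_add]
    map_smul' := fun r m => by ext x; simp [mul_left_comm] }

@[simp] theorem cliffOp_apply (p : Fin n) (m : WtIndex n J → K) (x : WtIndex n J) :
    (cliffOp K p).app m x = jwSign K p x * m (flipAt p x) := rfl

theorem cliffOp_mul_self (p : Fin n) : cliffOp (J := J) K p * cliffOp K p = 1 := by
  refine WtEnd.ext fun m x => ?_
  simp only [WtEnd.app_mul, cliffOp_apply, flipAt_flipAt, WtEnd.app_one,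
    ← mul_assoc, jwSign_flipAt_of_le K x le_rfl, jwSign_mul_self, one_mul]

/-- Flipping the earlier of the two slots negates the Jordan-Wigner sign of the later one but not
conversely, which leaves one net sign. -/
theorem cliffOp_mul_cliffOp {p q : Fin n} (h : p ≠ q) :
    cliffOp (J := J) K p * cliffOp K q = -(cliffOp K q * cliffOp K p) := by
  refine WtEnd.ext fun m x => ?_
  simp only [WtEnd.app_mul, cliffOp_apply, WtEnd.app_neg,
    flipAt_comm q p]
  have h' : x.1⁻¹ p ≠ x.1⁻¹ q := fun h' => h (x.1⁻¹.injective h')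
  rcases lt_or_gt_of_ne h' with h1 | h1
  · rw [jwSign_flipAt_of_lt K x h1, jwSign_flipAt_of_le K x h1.le]
    ring
  · rw [jwSign_flipAt_of_lt K x h1, jwSign_flipAt_of_le K x h1.le]
    ring

variable {K}

theorem cliffOp_mul_diagOp (p : Fin n) (f : WtIndex n J → K) :
    cliffOp K p * diagOp k f = diagOp k (fun x => f (flipAt p x)) * cliffOp K p := by
  refine WtEnd.ext fun m x => ?_
  simp only [WtEnd.app_mul, cliffOp_apply, diagOp_apply]
  ring

theorem cliffOp_mul_cliffOp_mul_diagOp (p q : Fin n) (f : WtIndex n J → K) :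
    cliffOp K p * cliffOp K q * diagOp k f
      = diagOp k (fun x => f (flipAt q (flipAt p x))) * (cliffOp K p * cliffOp K q) := by
  rw [mul_assoc, cliffOp_mul_diagOp, ← mul_assoc, cliffOp_mul_diagOp, mul_assoc]

variable [DecidableEq J] (y : Fin n → K) (c : J → J) (Q : J → J → MvPolynomial (Fin 2) k)

/-- The intertwining operator exchanging the positions `a` and `a + 1`. -/
noncomputable def twistOp (a : Fin (n - 1)) : WtEnd n J K :=
  show Module.End K (WtIndex n J → K) from {
    toFun := fun m x => coefK y c Q (lo a) (hi a) x * m (reflAt a x)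
    map_add' := fun m m' => by ext x; simp [mul_add]
    map_smul' := fun r m => by ext x; simp [mul_left_comm] }

variable {k}

@[simp] theorem twistOp_apply (a : Fin (n - 1)) (m : WtIndex n J → K) (x : WtIndex n J) :
    (twistOp k y c Q a).app m x = coefK y c Q (lo a) (hi a) x * m (reflAt a x) := rfl

theorem twistOp_mul_diagOp (a : Fin (n - 1)) (f : WtIndex n J → K) :
    twistOp k y c Q a * diagOp k f
      = diagOp k (fun x => f (reflAt a x)) * twistOp k y c Q a := by
  refine WtEnd.ext fun m x => ?_
  simp only [WtEnd.app_mul, twistOp_apply, diagOp_apply]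
  ring

variable {c Q}

theorem twistOp_mul_cliffOp (hQ : IsDatum c Q) (a : Fin (n - 1)) (p : Fin n) :
    twistOp k y c Q a * cliffOp K p = cliffOp K (simpleTransp a p) * twistOp k y c Q a := by
  refine WtEnd.ext fun m x => ?_
  simp only [WtEnd.app_mul, twistOp_apply, cliffOp_apply, reflAt_flipAt,
    simpleTransp_apply_self, jwSign_reflAt, coefK_flipAt y hQ (lo_ne_hi a)]
  ring

theorem twistOp_mul_self (hQ : IsDatum c Q) (a : Fin (n - 1)) :
    twistOp k y c Q a * twistOp k y c Q a = diagOp k (coefN y c Q (lo a) (hi a)) := by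
  refine WtEnd.ext fun m x => ?_
  simp only [WtEnd.app_mul, twistOp_apply, diagOp_apply, reflAt_reflAt, coefK_reflAt,
    simpleTransp_lo, simpleTransp_hi, ← mul_assoc, coefK_mul_coefK_swap y hQ (lo_ne_hi a)]

theorem twistOp_comm {a b : Fin (n - 1)} (hab : (a : ℕ) + 1 < b) :
    twistOp k y c Q a * twistOp k y c Q b = twistOp k y c Q b * twistOp k y c Q a := by
  have h1 : simpleTransp a (lo b) = lo b := by
    apply simpleTransp_of_ne <;> simp [lo, hi, Fin.ext_iff] <;> omega
  have h2 : simpleTransp a (hi b) = hi b := by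
    apply simpleTransp_of_ne <;> simp [lo, hi, Fin.ext_iff] <;> omega
  have h3 : simpleTransp b (lo a) = lo a := by
    apply simpleTransp_of_ne <;> simp [lo, hi, Fin.ext_iff] <;> omega
  have h4 : simpleTransp b (hi a) = hi a := by
    apply simpleTransp_of_ne <;> simp [lo, hi, Fin.ext_iff] <;> omega
  refine WtEnd.ext fun m x => ?_
  have hr : reflAt b (reflAt a x) = reflAt a (reflAt b x) := by
    simp only [reflAt, ← mul_assoc, simpleTransp_commute hab]
  simp only [WtEnd.app_mul, twistOp_apply, coefK_reflAt, h1, h2, h3, h4, hr]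
  ring

/-- Both sides reverse the three positions and multiply by the product of `coefK` over the three
increasing pairs among them. -/
theorem twistOp_braid {a b : Fin (n - 1)} (hab : (b : ℕ) = a + 1) :
    twistOp k y c Q a * twistOp k y c Q b * twistOp k y c Q a
      = twistOp k y c Q b * twistOp k y c Q a * twistOp k y c Q b := by
  have h0 : lo b = hi a := (RC.hi_eq_lo hab).symm
  have h1 : simpleTransp b (hi a) = hi b := by rw [← h0, simpleTransp_lo]
  have h2 : simpleTransp a (hi b) = hi b := by
    apply simpleTransp_of_ne <;> simp [lo, hi, Fin.ext_iff] <;> omega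
  have h3 : simpleTransp b (lo a) = lo a := by
    apply simpleTransp_of_ne <;> simp [lo, hi, Fin.ext_iff] <;> omega
  have h4 : simpleTransp b (hi b) = hi a := by rw [← h0, simpleTransp_hi]
  refine WtEnd.ext fun m x => ?_
  have hr : reflAt a (reflAt b (reflAt a x)) = reflAt b (reflAt a (reflAt b x)) := by
    simp only [reflAt, ← mul_assoc, simpleTransp_braid hab]
  simp only [WtEnd.app_mul, twistOp_apply, coefK_reflAt, h0, h1, h2, h3, h4, hr,
    simpleTransp_lo, simpleTransp_hi]
  ring

end Operators

/-! ### Products of pairs of Clifford operators. -/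

section CliffordProducts

variable {k : Type*} [CommRing k] {n : ℕ} {J : Type*} {K : Type*} [CommRing K] [Algebra k K]

theorem diagOp_commute (f g : WtIndex n J → K) : Commute (diagOp k f) (diagOp k g) := by
  rw [commute_iff_eq, ← map_mul, ← map_mul, mul_comm]

theorem diagOp_commute_cliffOp {f : WtIndex n J → K} {p : Fin n}
    (hf : ∀ x, f (flipAt p x) = f x) : Commute (diagOp k f) (cliffOp K p) := by
  rw [commute_iff_eq, cliffOp_mul_diagOp]
  simp only [hf]

theorem cliffOp_mul_mul_left {i j l : Fin n} (h : i ≠ j) :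
    cliffOp (J := J) K i * cliffOp K j * (cliffOp K i * cliffOp K l)
      = -(cliffOp K j * cliffOp K l) := by
  rw [cliffOp_mul_cliffOp K h, neg_mul, mul_assoc, ← mul_assoc (cliffOp K i) (cliffOp K i),
    cliffOp_mul_self, one_mul]

theorem cliffOp_mul_mul_right {i j l : Fin n} (h : j ≠ l) :
    cliffOp (J := J) K i * cliffOp K l * (cliffOp K j * cliffOp K l)
      = -(cliffOp K i * cliffOp K j) := by
  rw [cliffOp_mul_cliffOp K h, mul_neg, mul_assoc, ← mul_assoc (cliffOp K l) (cliffOp K l),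
    cliffOp_mul_self, one_mul]

theorem cliffOp_mul_mul_cyclic {i j l : Fin n} (hij : i ≠ j) (hil : i ≠ l) (hjl : j ≠ l) :
    cliffOp (J := J) K j * cliffOp K l * (cliffOp K i * cliffOp K j)
      = -(cliffOp K i * cliffOp K l) := by
  have h1 := cliffOp_mul_cliffOp (J := J) K hij
  have h2 := cliffOp_mul_cliffOp (J := J) K hil
  have h3 := cliffOp_mul_cliffOp (J := J) K hjl
  have h4 := cliffOp_mul_self (J := J) K j
  linear_combination (norm := noncomm_ring) cliffOp K j * cliffOp K l * h1
    - h3 * cliffOp K j * cliffOp K i + cliffOp K l * h4 * cliffOp K i + h2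

end CliffordProducts

/-! ### The operators of the `σ_a`: quadratic, braid and Clifford relations. -/

section Sigma

variable {k : Type*} [CommRing k] {n : ℕ} {J : Type*} [DecidableEq J]
  {K : Type*} [CommRing K] [Algebra k K] (y : Fin n → K)
  (c : J → J) (Q : J → J → MvPolynomial (Fin 2) k)

variable (k) in
/-- The solution of the classical Yang-Baxter equation. -/
noncomputable def rOp (i j : Fin n) : WtEnd n J K :=
  diagOp k (coefA y c i j) + diagOp k (coefB y c i j) * (cliffOp K i * cliffOp K j)

/-- The operator of `σ_a`. -/
noncomputable def sigmaOp (a : Fin (n - 1)) : WtEnd n J K :=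
  rOp k y c (lo a) (hi a) + twistOp k y c Q a

/-- The operator of `y_p`. -/
noncomputable def yOp (k : Type*) [CommRing k] [Algebra k K] (J : Type*) (p : Fin n) :
    WtEnd n J K := diagOp k (wtY y p)

variable (k K) in
/-- The operator of `e(ν)`. -/
noncomputable def idemOp (ν : Fin n → J) : WtEnd n J K :=
  diagOp k fun x => if colour c x = ν then 1 else 0

variable {c Q}

theorem diagOp_commute_rOp {f : WtIndex n J → K} {i j : Fin n}
    (hi : ∀ x, f (flipAt i x) = f x) (hj : ∀ x, f (flipAt j x) = f x) :
    Commute (diagOp k f) (rOp k y c i j) :=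
  (diagOp_commute _ _).add_right ((diagOp_commute _ _).mul_right
    ((diagOp_commute_cliffOp hi).mul_right (diagOp_commute_cliffOp hj)))

theorem rOp_swap (hc : Function.Involutive c) {i j : Fin n} (h : i ≠ j) :
    rOp k y c j i = -rOp k y c i j := by
  have hA : coefA y c j i = -coefA y c i j := funext fun x => coefA_swap y i j x
  have hB : coefB y c j i = coefB y c i j := funext fun x => coefB_swap y hc i j x
  rw [rOp, rOp, hA, hB, cliffOp_mul_cliffOp K h.symm, map_neg, mul_neg, neg_add]

/-- `c_i c_j` squares to `-1` and anticommutes with both coefficients, since each changes sign when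
both slots are flipped; so the cross terms cancel. -/
theorem rOp_mul_self (hc : Function.Involutive c) {i j : Fin n} (h : i ≠ j) :
    rOp k y c i j * rOp k y c i j
      = diagOp k fun x => coefA y c i j x ^ 2 + coefB y c i j x ^ 2 := by
  have hA : cliffOp K i * cliffOp K j * diagOp k (coefA y c i j)
      = -(diagOp k (coefA y c i j) * (cliffOp K i * cliffOp K j)) := by
    rw [cliffOp_mul_cliffOp_mul_diagOp, ← neg_mul, ← map_neg]
    congr 2
    ext x
    rw [coefA_flipAt_right y hc h, coefB_flipAt_left y hc h, Pi.neg_apply]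
  have hB : cliffOp K i * cliffOp K j * diagOp k (coefB y c i j)
      = -(diagOp k (coefB y c i j) * (cliffOp K i * cliffOp K j)) := by
    rw [cliffOp_mul_cliffOp_mul_diagOp, ← neg_mul, ← map_neg]
    congr 2
    ext x
    rw [coefB_flipAt_right y hc h, coefA_flipAt_left y hc h, Pi.neg_apply]
  have hcc : cliffOp (J := J) K i * cliffOp K j * (cliffOp K i * cliffOp K j) = -1 := by
    rw [cliffOp_mul_mul_left h, cliffOp_mul_self]
  have hAB := (diagOp_commute (k := k) (coefA y c i j) (coefB y c i j)).eq
  have e : (diagOp k fun x => coefA y c i j x ^ 2 + coefB y c i j x ^ 2)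
      = diagOp k (coefA y c i j) * diagOp k (coefA y c i j)
        + diagOp k (coefB y c i j) * diagOp k (coefB y c i j) := by
    rw [← map_mul, ← map_mul, ← map_add]
    congr 1
    ext x
    simp [sq]
  rw [e, rOp]
  linear_combination (norm := noncomm_ring) diagOp k (coefB y c i j) * hA
    + diagOp k (coefB y c i j) * hB * (cliffOp K i * cliffOp K j)
    - diagOp k (coefB y c i j) * diagOp k (coefB y c i j) * hcc
    + hAB * (cliffOp K i * cliffOp K j)

theorem rOp_yangBaxter (hc : Function.Involutive c) (hy : IsGeneric y) {i j l : Fin n}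
    (hij : i ≠ j) (hil : i ≠ l) (hjl : j ≠ l) :
    rOp k y c i j * rOp k y c i l + rOp k y c i l * rOp k y c j l
      = rOp k y c j l * rOp k y c i j := by
  refine yangBaxter_of_coef (cliffOp_mul_mul_left hij) (cliffOp_mul_mul_right hjl)
    (cliffOp_mul_mul_cyclic hij hil hjl) ?_ ?_ ?_ ?_ ?_ ?_ ?_ ?_ ?_ ?_
  · rw [cliffOp_mul_cliffOp_mul_diagOp]
    congr 2; ext x
    rw [coefA_flipAt_of_ne y hij hjl.symm, coefA_flipAt_left y hc hil]
  · rw [cliffOp_mul_cliffOp_mul_diagOp]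
    congr 2; ext x
    rw [coefB_flipAt_of_ne y hij hjl.symm, coefB_flipAt_left y hc hil]
  · rw [cliffOp_mul_cliffOp_mul_diagOp, ← neg_mul, ← map_neg]
    congr 2; ext x
    rw [coefA_flipAt_right y hc hjl, coefB_flipAt_of_ne y hij.symm hil.symm, Pi.neg_apply]
  · rw [cliffOp_mul_cliffOp_mul_diagOp, ← neg_mul, ← map_neg]
    congr 2; ext x
    rw [coefB_flipAt_right y hc hjl, coefA_flipAt_of_ne y hij.symm hil.symm, Pi.neg_apply]
  · rw [cliffOp_mul_cliffOp_mul_diagOp, ← neg_mul, ← map_neg]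
    congr 2; ext x
    rw [coefA_flipAt_of_ne y hil hjl, coefA_flipAt_right y hc hij, Pi.neg_apply]
  · rw [cliffOp_mul_cliffOp_mul_diagOp, ← neg_mul, ← map_neg]
    congr 2; ext x
    rw [coefB_flipAt_of_ne y hil hjl, coefB_flipAt_right y hc hij, Pi.neg_apply]
  · simp only [← map_mul, ← map_add]
    congr 1; ext x
    exact coefA_coefA_identity hy hij hil hjl x
  · simp only [← map_mul, ← map_add]
    congr 1; ext x
    exact coefB_coefB_identity hc hy hij hil hjl x
  · simp only [← map_mul, ← map_sub]
    congr 1; ext x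
    simp only [Pi.mul_apply, Pi.sub_apply]
    linear_combination -coefA_coefB_identity hy hij hil hjl x
  · simp only [← map_mul, ← map_sub, ← map_neg]
    congr 1; ext x
    simp only [Pi.mul_apply, Pi.sub_apply, Pi.neg_apply]
    linear_combination coefB_coefA_identity hc hy hij hil hjl x

/-- The Yang-Baxter equation for the reversed triple `l, j, i`, rewritten by antisymmetry. -/
theorem rOp_yangBaxter' (hc : Function.Involutive c) (hy : IsGeneric y) {i j l : Fin n}
    (hij : i ≠ j) (hil : i ≠ l) (hjl : j ≠ l) :
    rOp k y c j l * rOp k y c i l + rOp k y c i l * rOp k y c i j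
      = rOp k y c i j * rOp k y c j l := by
  have h := rOp_yangBaxter (k := k) y hc hy hjl.symm hil.symm hij.symm
  rw [rOp_swap y hc hij, rOp_swap y hc hil, rOp_swap y hc hjl] at h
  simpa only [neg_mul_neg] using h

theorem twistOp_mul_rOp (hQ : IsDatum c Q) (a : Fin (n - 1)) (i j : Fin n) :
    twistOp k y c Q a * rOp k y c i j
      = rOp k y c (simpleTransp a i) (simpleTransp a j) * twistOp k y c Q a := by
  have hA : (fun x => coefA y c i j (reflAt a x))
      = coefA y c (simpleTransp a i) (simpleTransp a j) :=
    funext fun x => coefA_reflAt y a i j x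
  have hB : (fun x => coefB y c i j (reflAt a x))
      = coefB y c (simpleTransp a i) (simpleTransp a j) :=
    funext fun x => coefB_reflAt y a i j x
  have hcc : twistOp k y c Q a * (cliffOp K i * cliffOp K j)
      = cliffOp K (simpleTransp a i) * cliffOp K (simpleTransp a j) * twistOp k y c Q a := by
    rw [← mul_assoc, twistOp_mul_cliffOp y hQ, mul_assoc, twistOp_mul_cliffOp y hQ, mul_assoc]
  rw [rOp, rOp, mul_add, add_mul, twistOp_mul_diagOp, hA,
    ← mul_assoc _ (diagOp k (coefB y c i j)), twistOp_mul_diagOp, hB, mul_assoc, hcc]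
  simp only [mul_assoc]

theorem rOp_mul_self_add (hQ : IsDatum c Q) (a : Fin (n - 1)) :
    rOp k y c (lo a) (hi a) * rOp k y c (lo a) (hi a) + twistOp k y c Q a * twistOp k y c Q a
      = diagOp k (coefQ y c Q (lo a) (hi a)) := by
  rw [rOp_mul_self y hQ.involutive (lo_ne_hi a), twistOp_mul_self y hQ, ← map_add]
  congr 1
  ext x
  simp only [coefN, Pi.add_apply]
  ring

/-- The intertwiner carries `r_{a,a+1}` to `r_{a+1,a} = -r_{a,a+1}`, so the cross terms cancel. -/
theorem sigmaOp_mul_self (hQ : IsDatum c Q) (a : Fin (n - 1)) :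
    sigmaOp y c Q a * sigmaOp y c Q a = diagOp k (coefQ y c Q (lo a) (hi a)) := by
  have h := twistOp_mul_rOp (k := k) y hQ a (lo a) (hi a)
  rw [simpleTransp_lo, simpleTransp_hi, rOp_swap y hQ.involutive (lo_ne_hi a)] at h
  rw [← rOp_mul_self_add y hQ, sigmaOp]
  linear_combination (norm := noncomm_ring) h

theorem sigmaOp_braid (hQ : IsDatum c Q) (hy : IsGeneric y) {a b : Fin (n - 1)}
    (hab : (b : ℕ) = a + 1) :
    sigmaOp y c Q b * sigmaOp y c Q a * sigmaOp y c Q b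
        - sigmaOp y c Q a * sigmaOp y c Q b * sigmaOp y c Q a
      = (diagOp k (coefQ y c Q (lo b) (hi b)) - diagOp k (coefQ y c Q (lo a) (hi a)))
        * rOp k y c (lo a) (hi b) := by
  have h0 : lo b = hi a := (RC.hi_eq_lo hab).symm
  have h1 : simpleTransp b (hi a) = hi b := by rw [← h0, simpleTransp_lo]
  have hne : lo a ≠ hi b := by simp [lo, hi, Fin.ext_iff]; omega
  have hne' : hi a ≠ hi b := h0 ▸ lo_ne_hi b
  have h2 : simpleTransp a (hi b) = hi b := simpleTransp_of_ne a hne.symm hne'.symm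
  have h3 : simpleTransp b (lo a) = lo a := simpleTransp_of_ne b (h0 ▸ lo_ne_hi a) hne
  have h4 : simpleTransp b (hi b) = hi a := by rw [← h0, simpleTransp_hi]
  have hc := hQ.involutive
  have hb := rOp_mul_self_add (k := k) y hQ b
  rw [h0] at hb
  rw [sigmaOp, sigmaOp, h0]
  refine braid_of_yangBaxter (twistOp_braid y hab) ?_ ?_ ?_ ?_ ?_ ?_
    (rOp_mul_self_add y hQ a) hb
    (rOp_yangBaxter y hc hy (lo_ne_hi a) hne hne') (rOp_yangBaxter' y hc hy (lo_ne_hi a) hne hne')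
    (diagOp_commute_rOp y (coefQ_flipAt y hQ (lo_ne_hi a) _)
      (coefQ_flipAt y hQ (lo_ne_hi a) _)).eq
    (diagOp_commute_rOp y (coefQ_flipAt y hQ hne' _)
      (coefQ_flipAt y hQ hne' _)).eq ?_
  · rw [twistOp_mul_rOp y hQ, simpleTransp_lo, simpleTransp_hi, rOp_swap y hc (lo_ne_hi a),
      neg_mul]
  · rw [twistOp_mul_rOp y hQ, simpleTransp_hi, h2]
  · rw [twistOp_mul_rOp y hQ, simpleTransp_lo, h2]
  · rw [twistOp_mul_rOp y hQ, h1, h4, rOp_swap y hc hne', neg_mul]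
  · rw [twistOp_mul_rOp y hQ, h1, h3]
  · rw [twistOp_mul_rOp y hQ, h3, h4]
  · rw [rOp_mul_self y hc hne']
    exact (diagOp_commute_rOp y (sq_add_sq_flipAt y hc hne' _) (sq_add_sq_flipAt y hc hne' _)).eq

theorem rOp_mul_cliffOp_of_ne {i j p : Fin n} (hi : i ≠ p) (hj : j ≠ p) :
    rOp k y c i j * cliffOp K p = cliffOp K p * rOp k y c i j := by
  have hA : Commute (diagOp k (coefA y c i j)) (cliffOp K p) :=
    diagOp_commute_cliffOp (coefA_flipAt_of_ne y hi hj)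
  have hB : Commute (diagOp k (coefB y c i j)) (cliffOp K p) :=
    diagOp_commute_cliffOp (coefB_flipAt_of_ne y hi hj)
  have hcc : Commute (cliffOp (J := J) K i * cliffOp K j) (cliffOp K p) := by
    rw [commute_iff_eq, mul_assoc, cliffOp_mul_cliffOp K hj, mul_neg, ← mul_assoc,
      cliffOp_mul_cliffOp K hi, neg_mul, neg_neg, mul_assoc]
  exact (hA.add_left (hB.mul_left hcc)).eq

theorem rOp_mul_cliffOp_left (hc : Function.Involutive c) {i j : Fin n} (h : i ≠ j) :
    rOp k y c i j * cliffOp K i = cliffOp K j * rOp k y c i j := by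
  have hA : (fun x => coefA y c i j (flipAt j x)) = -coefB y c i j :=
    funext fun x => coefA_flipAt_right y hc h x
  have hB : (fun x => coefB y c i j (flipAt j x)) = -coefA y c i j :=
    funext fun x => coefB_flipAt_right y hc h x
  have hc1 : cliffOp (J := J) K i * cliffOp K j * cliffOp K i = -cliffOp K j := by
    rw [cliffOp_mul_cliffOp K h, neg_mul, mul_assoc, cliffOp_mul_self, mul_one]
  have hc2 : cliffOp (J := J) K j * (cliffOp K i * cliffOp K j) = -cliffOp K i := by
    rw [cliffOp_mul_cliffOp K h, mul_neg, ← mul_assoc, cliffOp_mul_self, one_mul]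
  rw [rOp, add_mul, mul_add, mul_assoc (diagOp k (coefB y c i j)), hc1, cliffOp_mul_diagOp,
    ← mul_assoc (cliffOp K j), cliffOp_mul_diagOp, hA, hB, mul_assoc _ (cliffOp K j), hc2,
    map_neg, map_neg]
  noncomm_ring

theorem rOp_mul_cliffOp_right (hc : Function.Involutive c) {i j : Fin n} (h : i ≠ j) :
    rOp k y c i j * cliffOp K j = cliffOp K i * rOp k y c i j := by
  have h1 := rOp_mul_cliffOp_left (k := k) y hc h.symm
  rw [rOp_swap y hc h, neg_mul, mul_neg, neg_inj] at h1
  exact h1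

theorem sigmaOp_mul_cliffOp (hQ : IsDatum c Q) (a : Fin (n - 1)) (p : Fin n) :
    sigmaOp y c Q a * cliffOp K p = cliffOp K (simpleTransp a p) * sigmaOp y c Q a := by
  rw [sigmaOp, add_mul, mul_add, twistOp_mul_cliffOp y hQ]
  congr 1
  by_cases h1 : p = lo a
  · rw [h1, simpleTransp_lo, rOp_mul_cliffOp_left y hQ.involutive (lo_ne_hi a)]
  · by_cases h2 : p = hi a
    · rw [h2, simpleTransp_hi, rOp_mul_cliffOp_right y hQ.involutive (lo_ne_hi a)]
    · rw [simpleTransp_of_ne a h1 h2, rOp_mul_cliffOp_of_ne y (Ne.symm h1) (Ne.symm h2)]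

theorem rOp_commute_rOp {i j l m : Fin n} (hil : i ≠ l) (him : i ≠ m) (hjl : j ≠ l)
    (hjm : j ≠ m) : Commute (rOp k y c i j) (rOp k y c l m) := by
  have h1 : Commute (rOp k y c i j) (diagOp k (coefA y c l m)) :=
    (diagOp_commute_rOp y (coefA_flipAt_of_ne y hil.symm him.symm)
      (coefA_flipAt_of_ne y hjl.symm hjm.symm)).symm
  have h2 : Commute (rOp k y c i j) (diagOp k (coefB y c l m)) :=
    (diagOp_commute_rOp y (coefB_flipAt_of_ne y hil.symm him.symm)
      (coefB_flipAt_of_ne y hjl.symm hjm.symm)).symm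
  exact h1.add_right (h2.mul_right
    ((show Commute _ _ from rOp_mul_cliffOp_of_ne y hil hjl).mul_right
      (rOp_mul_cliffOp_of_ne y him hjm)))

theorem sigmaOp_comm (hQ : IsDatum c Q) {a b : Fin (n - 1)} (hab : (a : ℕ) + 1 < b) :
    sigmaOp y c Q a * sigmaOp y c Q b = sigmaOp y c Q b * sigmaOp (k := k) y c Q a := by
  have n1 : lo a ≠ lo b := by simp [lo, Fin.ext_iff]; omega
  have n2 : lo a ≠ hi b := by simp [lo, hi, Fin.ext_iff]; omega
  have n3 : hi a ≠ lo b := by simp [lo, hi, Fin.ext_iff]; omega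
  have n4 : hi a ≠ hi b := by simp [hi, Fin.ext_iff]; omega
  have h1 : Commute (twistOp k y c Q a) (rOp k y c (lo b) (hi b)) := by
    rw [commute_iff_eq, twistOp_mul_rOp y hQ, simpleTransp_of_ne a n1.symm n3.symm,
      simpleTransp_of_ne a n2.symm n4.symm]
  have h2 : Commute (twistOp k y c Q b) (rOp k y c (lo a) (hi a)) := by
    rw [commute_iff_eq, twistOp_mul_rOp y hQ, simpleTransp_of_ne b n1 n2,
      simpleTransp_of_ne b n3 n4]
  have h3 : Commute (twistOp k y c Q a) (twistOp k y c Q b) := twistOp_comm y hab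
  exact (((rOp_commute_rOp y n1 n2 n3 n4).add_right h2.symm).add_left (h1.add_right h3)).eq

end Sigma

/-! ### Divided differences as fractions. -/

section DivDiff

variable {k A B : Type*} [CommRing k] [CommRing A] [CommRing B] [Algebra k A] [Algebra k B]

theorem map_divDiff (φ : A →ₐ[k] B) (P : MvPolynomial (Fin 2) k) (u w v : A) :
    φ (divDiff P u w v) = divDiff P (φ u) (φ w) (φ v) := by
  simp [divDiff, map_sum]

theorem divDiff_eq_mul_inverse (P : MvPolynomial (Fin 2) k) (u w v z : A) (hz : IsUnit z)
    (h : z = u - w) : divDiff P u w v =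
      (MvPolynomial.aeval ![u, v] P - MvPolynomial.aeval ![w, v] P) * Ring.inverse z := by
  rw [← divDiff_mul, ← h, mul_assoc, Ring.mul_inverse_cancel _ hz, mul_one]

end DivDiff

/-! ### Idempotent and `y` relations, and the action of the free algebra. -/

section Representation

variable {k : Type*} [CommRing k] {n : ℕ} {J : Type*}
  {K : Type*} [CommRing K] [Algebra k K] (y : Fin n → K)
  {c : J → J}

theorem colour_comp_simpleTransp {x : WtIndex n J} {a : Fin (n - 1)}
    (h : colour c x (lo a) = colour c x (hi a)) :
    colour c x ∘ simpleTransp a = colour c x := by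
  ext p
  by_cases h1 : p = lo a
  · simp [h1, h]
  · by_cases h2 : p = hi a
    · simp [h2, h]
    · simp [simpleTransp_of_ne a h1 h2]

theorem colour_flipAt_flipAt (hc : Function.Involutive c) {i j : Fin n} (h : i ≠ j)
    (x : WtIndex n J) : colour c (flipAt j (flipAt i x))
      = Function.update (Function.update (colour c x) i (c (colour c x i)))
          j (c (colour c x j)) := by
  rw [colour_flipAt hc, colour_flipAt hc, Function.update_of_ne h.symm]

theorem colour_flipAt_flipAt_eq_comp (hc : Function.Involutive c) {x : WtIndex n J}
    {a : Fin (n - 1)} (h : colour c x (lo a) = c (colour c x (hi a))) :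
    colour c (flipAt (hi a) (flipAt (lo a) x)) = colour c x ∘ simpleTransp a := by
  rw [colour_flipAt_flipAt hc (lo_ne_hi a)]
  ext p
  by_cases h2 : p = hi a
  · simp [h2, h]
  · by_cases h1 : p = lo a
    · rw [h1, Function.update_of_ne (lo_ne_hi a), Function.update_self, h, hc]
      simp
    · simp [Function.update_of_ne h1, Function.update_of_ne h2, simpleTransp_of_ne a h1 h2]

theorem colour_opposite_iff (hc : Function.Involutive c) {i j : Fin n} (hij : i ≠ j)
    {x : WtIndex n J} {ν : Fin n → J} (hx : colour c (flipAt j (flipAt i x)) = ν) :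
    colour c x i = c (ν i) ∧ colour c x j = c (ν j) ∧
      ∀ p, p ≠ i → p ≠ j → colour c x p = ν p := by
  rw [colour_flipAt_flipAt hc hij] at hx
  subst hx
  refine ⟨?_, ?_, fun p hi hj => ?_⟩
  · rw [Function.update_of_ne hij, Function.update_self, hc]
  · rw [Function.update_self, hc]
  · rw [Function.update_of_ne hj, Function.update_of_ne hi]

theorem cliffOp_mul_yOp (p q : Fin n) :
    cliffOp K p * yOp y k J q
      = (if p = q then -1 else 1) * (yOp y k J q * cliffOp K p) := by
  rw [yOp, cliffOp_mul_diagOp]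
  split_ifs with h
  · subst h
    have : (fun x : WtIndex n J => wtY y p (flipAt p x)) = -wtY y p :=
      funext fun x => wtY_flipAt_same y p x
    rw [this, map_neg, neg_mul, neg_mul, one_mul]
  · simp only [wtY_flipAt_of_ne y (Ne.symm h), one_mul]

variable [DecidableEq J] {Q : J → J → MvPolynomial (Fin 2) k}

theorem diagOp_mul_idemOp {f g : WtIndex n J → K} {ν : Fin n → J}
    (h : ∀ x, colour c x = ν → f x = g x) :
    diagOp k f * idemOp k K c ν = diagOp k g * idemOp k K c ν := by
  rw [idemOp, ← map_mul, ← map_mul]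
  congr 1
  ext x
  by_cases hx : colour c x = ν
  · simp [hx, h x hx]
  · simp [hx]

theorem diagOp_mul_cliffOp_mul_idemOp {f g : WtIndex n J → K} {i j : Fin n} {ν : Fin n → J}
    (h : ∀ x, colour c (flipAt j (flipAt i x)) = ν → f x = g x) :
    diagOp k f * (cliffOp K i * cliffOp K j * idemOp k K c ν)
      = diagOp k g * (cliffOp K i * cliffOp K j * idemOp k K c ν) := by
  rw [idemOp, cliffOp_mul_cliffOp_mul_diagOp, ← mul_assoc (diagOp k f),
    ← mul_assoc (diagOp k g), ← map_mul, ← map_mul]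
  congr 2
  ext x
  by_cases hx : colour c (flipAt j (flipAt i x)) = ν
  · simp [hx, h x hx]
  · simp [hx]

theorem diagOp_same_mul_idemOp (i j : Fin n) (ν : Fin n → J) :
    diagOp k (fun x => if colour c x i = colour c x j then (1 : K) else 0) * idemOp k K c ν
      = if ν i = ν j then idemOp k K c ν else 0 := by
  rw [diagOp_mul_idemOp (g := fun _ => if ν i = ν j then 1 else 0) fun x hx => by rw [hx]]
  split_ifs
  · exact (congrArg (· * idemOp k K c ν) (map_one (diagOp k))).trans (one_mul _)
  · exact (congrArg (· * idemOp k K c ν) (map_zero (diagOp k))).trans (zero_mul _)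

theorem diagOp_opposite_mul_idemOp (hc : Function.Involutive c) {i j : Fin n} (hij : i ≠ j)
    (ν : Fin n → J) :
    diagOp k (fun x => if colour c x i = c (colour c x j) then (1 : K) else 0)
        * (cliffOp K i * cliffOp K j * idemOp k K c ν)
      = if ν i = c (ν j) then cliffOp K i * cliffOp K j * idemOp k K c ν else 0 := by
  rw [diagOp_mul_cliffOp_mul_idemOp (g := fun _ => if ν i = c (ν j) then 1 else 0) fun x hx => by
    obtain ⟨h1, h2, -⟩ := colour_opposite_iff hc hij hx
    simp only [h1, h2, hc.injective.eq_iff]]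
  split_ifs
  · exact (congrArg (· * _) (map_one (diagOp k))).trans (one_mul _)
  · exact (congrArg (· * _) (map_zero (diagOp k))).trans (zero_mul _)

theorem idemOp_mul_idemOp (μ ν : Fin n → J) :
    idemOp k K c μ * idemOp k K c ν = if μ = ν then idemOp k K c μ else 0 := by
  rw [idemOp, idemOp, ← map_mul]
  split_ifs with h
  · subst h
    congr 1
    ext x
    by_cases hx : colour c x = μ <;> simp [hx]
  · rw [← map_zero (diagOp k)]
    congr 1
    ext x
    by_cases hx : colour c x = μ
    · simp [hx, h]
    · simp [hx]

theorem sum_idemOp [Fintype J] : ∑ ν : Fin n → J, idemOp k K c ν = 1 := by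
  unfold idemOp
  rw [← map_sum, ← map_one (diagOp k)]
  congr 1
  ext x
  simp

theorem cliffOp_mul_idemOp (hc : Function.Involutive c) (p : Fin n) (ν : Fin n → J) :
    cliffOp K p * idemOp k K c ν
      = idemOp k K c (Function.update ν p (c (ν p))) * cliffOp K p := by
  rw [idemOp, idemOp, cliffOp_mul_diagOp]
  congr 2
  ext x
  congr 1
  rw [colour_flipAt hc, eq_iff_iff]
  constructor
  · rintro rfl
    simp [hc _]
  · intro h
    simp [h, hc _]

/-- Each summand exchanges the colours at `a` and `a + 1`: the intertwiner by construction, the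
`coefA` term because it lives where they are equal, and the `coefB` term because flipping two
colours exchanged by `c` swaps them. -/
theorem sigmaOp_mul_idemOp (hc : Function.Involutive c) (a : Fin (n - 1)) (ν : Fin n → J) :
    sigmaOp y c Q a * idemOp k K c ν
      = idemOp k K c (ν ∘ simpleTransp a) * sigmaOp y c Q a := by
  have hs : ∀ f g : Fin n → J, f ∘ simpleTransp a = g ↔ f = g ∘ simpleTransp a := by
    intro f g
    constructor
    · rintro rfl
      ext p
      simp
    · rintro rfl
      ext p
      simp
  have h1 : (fun x => (if colour c (reflAt a x) = ν then 1 else 0 : K))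
      = fun x => if colour c x = ν ∘ simpleTransp a then 1 else 0 := by
    ext x
    have : colour c (reflAt a x) = colour c x ∘ simpleTransp a :=
      funext fun p => colour_reflAt c a x p
    simp only [this, hs]
  have h2 : coefA y c (lo a) (hi a) * (fun x => (if colour c x = ν then 1 else 0 : K))
      = (fun x => if colour c x = ν ∘ simpleTransp a then 1 else 0)
        * coefA y c (lo a) (hi a) := by
    ext x
    simp only [Pi.mul_apply, coefA]
    split_ifs with e1 e2 e3 e3
    · simp
    · exact absurd ((hs _ _).1 ((colour_comp_simpleTransp e1).trans e2)) e3
    · exact absurd ((colour_comp_simpleTransp e1).symm.trans ((hs _ _).2 e3)) e2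
    all_goals simp
  have h3 : coefB y c (lo a) (hi a)
        * (fun x => (if colour c (flipAt (hi a) (flipAt (lo a) x)) = ν then 1 else 0 : K))
      = (fun x => if colour c x = ν ∘ simpleTransp a then 1 else 0)
        * coefB y c (lo a) (hi a) := by
    ext x
    simp only [Pi.mul_apply, coefB]
    by_cases e1 : colour c x (lo a) = c (colour c x (hi a))
    · simp only [colour_flipAt_flipAt_eq_comp hc e1, hs, mul_comm]
    · simp [e1]
  rw [sigmaOp, rOp, idemOp, idemOp, add_mul, add_mul, mul_add, mul_add, twistOp_mul_diagOp, h1,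
    mul_assoc, cliffOp_mul_cliffOp_mul_diagOp, ← mul_assoc (diagOp k (coefB y c _ _)),
    ← map_mul, ← map_mul, h2, h3, map_mul, map_mul, mul_assoc (diagOp k _) (diagOp k _)]

theorem sigmaOp_mul_yOp (a : Fin (n - 1)) {p : Fin n} (h : p ≠ lo a) (h' : p ≠ hi a) :
    sigmaOp y c Q a * yOp y k J p = yOp y k J p * sigmaOp y c Q a := by
  have h1 : (fun x : WtIndex n J => wtY y p (reflAt a x)) = wtY y p :=
    funext fun x => by rw [wtY_reflAt, simpleTransp_of_ne a h h']
  rw [sigmaOp, yOp, add_mul, mul_add, twistOp_mul_diagOp, h1,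
    (diagOp_commute_rOp y (wtY_flipAt_of_ne y h) (wtY_flipAt_of_ne y h')).eq]

/-- The intertwiner contributes nothing. In `rOp` the denominators cancel; the minus sign appears
because `c_a c_{a+1}` anticommutes with `y_{a+1}`. -/
theorem sigmaOp_mul_yOp_hi_sub (hy : IsGeneric y) (a : Fin (n - 1)) :
    sigmaOp y c Q a * yOp y k J (hi a) - yOp y k J (lo a) * sigmaOp y c Q a
      = diagOp k (fun x => if colour c x (lo a) = colour c x (hi a) then 1 else 0)
        - diagOp k (fun x => if colour c x (lo a) = c (colour c x (hi a)) then 1 else 0)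
          * (cliffOp K (lo a) * cliffOp K (hi a)) := by
  have h1 : (fun x : WtIndex n J => wtY y (hi a) (reflAt a x)) = wtY y (lo a) :=
    funext fun x => by rw [wtY_reflAt, simpleTransp_hi]
  have h2 : (fun x : WtIndex n J => wtY y (hi a) (flipAt (hi a) (flipAt (lo a) x)))
      = -wtY y (hi a) :=
    funext fun x => by
      rw [wtY_flipAt_same, wtY_flipAt_of_ne y (lo_ne_hi a).symm, Pi.neg_apply]
  have h3 : (fun x => if colour c x (lo a) = colour c x (hi a) then (1 : K) else 0)
      = coefA y c (lo a) (hi a) * wtY y (hi a) - wtY y (lo a) * coefA y c (lo a) (hi a) := by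
    ext x
    simp only [Pi.mul_apply, Pi.sub_apply, coefA]
    split_ifs
    · rw [mul_comm, ← sub_mul, Ring.mul_inverse_cancel _ (hy.isUnit_wtY (lo_ne_hi a) x).1]
    · simp
  have h4 : (fun x => if colour c x (lo a) = c (colour c x (hi a)) then (1 : K) else 0)
      = coefB y c (lo a) (hi a) * wtY y (hi a) + wtY y (lo a) * coefB y c (lo a) (hi a) := by
    ext x
    simp only [Pi.mul_apply, Pi.add_apply, coefB]
    split_ifs
    · rw [mul_comm, ← add_mul, add_comm,
        Ring.mul_inverse_cancel _ (hy.isUnit_wtY (lo_ne_hi a) x).2]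
    · simp
  rw [h3, h4, map_sub, map_add, map_mul, map_mul, map_mul, map_mul, sigmaOp, rOp, yOp, yOp,
    add_mul, add_mul, twistOp_mul_diagOp, h1, mul_assoc (diagOp k (coefB y c _ _)),
    cliffOp_mul_cliffOp_mul_diagOp, h2, map_neg]
  noncomm_ring

theorem yOp_hi_mul_sigmaOp_sub (hy : IsGeneric y) (a : Fin (n - 1)) :
    yOp y k J (hi a) * sigmaOp y c Q a - sigmaOp y c Q a * yOp y k J (lo a)
      = diagOp k (fun x => if colour c x (lo a) = colour c x (hi a) then 1 else 0)
        + diagOp k (fun x => if colour c x (lo a) = c (colour c x (hi a)) then 1 else 0)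
          * (cliffOp K (lo a) * cliffOp K (hi a)) := by
  have h1 : (fun x : WtIndex n J => wtY y (lo a) (reflAt a x)) = wtY y (hi a) :=
    funext fun x => by rw [wtY_reflAt, simpleTransp_lo]
  have h2 : (fun x : WtIndex n J => wtY y (lo a) (flipAt (hi a) (flipAt (lo a) x)))
      = -wtY y (lo a) :=
    funext fun x => by
      rw [wtY_flipAt_of_ne y (lo_ne_hi a), wtY_flipAt_same, Pi.neg_apply]
  have h3 : (fun x => if colour c x (lo a) = colour c x (hi a) then (1 : K) else 0)
      = wtY y (hi a) * coefA y c (lo a) (hi a) - coefA y c (lo a) (hi a) * wtY y (lo a) := by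
    ext x
    simp only [Pi.mul_apply, Pi.sub_apply, coefA]
    split_ifs
    · rw [mul_comm (Ring.inverse _), ← sub_mul,
        Ring.mul_inverse_cancel _ (hy.isUnit_wtY (lo_ne_hi a) x).1]
    · simp
  have h4 : (fun x => if colour c x (lo a) = c (colour c x (hi a)) then (1 : K) else 0)
      = wtY y (hi a) * coefB y c (lo a) (hi a) + coefB y c (lo a) (hi a) * wtY y (lo a) := by
    ext x
    simp only [Pi.mul_apply, Pi.add_apply, coefB]
    split_ifs
    · rw [mul_comm (Ring.inverse _), ← add_mul, add_comm,
        Ring.mul_inverse_cancel _ (hy.isUnit_wtY (lo_ne_hi a) x).2]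
    · simp
  rw [h3, h4, map_sub, map_add, map_mul, map_mul, map_mul, map_mul, sigmaOp, rOp, yOp, yOp,
    add_mul, add_mul, twistOp_mul_diagOp, h1, mul_assoc (diagOp k (coefB y c _ _)),
    cliffOp_mul_cliffOp_mul_diagOp, h2, map_neg]
  noncomm_ring

variable (c Q)

/-- The operators of the generators. -/
noncomputable def genOp : Gen n J → WtEnd n J K
  | .y p => yOp y k J p
  | .c p => cliffOp K p
  | .s a => sigmaOp y c Q a
  | .e ν => idemOp k K c ν

/-- The representation of the free algebra. -/
noncomputable def freeRep : FreeAlgebra k (Gen n J) →ₐ[k] WtEnd n J K :=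
  FreeAlgebra.lift k (genOp y c Q)

theorem freeRep_y (p : Fin n) : freeRep y c Q (fy k J p) = yOp y k J p :=
  FreeAlgebra.lift_ι_apply _ _

theorem freeRep_c (p : Fin n) : freeRep y c Q (fc k J p) = cliffOp K p :=
  FreeAlgebra.lift_ι_apply _ _

theorem freeRep_s (a : Fin (n - 1)) : freeRep y c Q (fs k J a) = sigmaOp y c Q a :=
  FreeAlgebra.lift_ι_apply _ _

theorem freeRep_e (ν : Fin n → J) : freeRep y c Q (fe k ν) = idemOp k K c ν :=
  FreeAlgebra.lift_ι_apply _ _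

theorem freeRep_fpoly (P : MvPolynomial (Fin n) k) :
    freeRep y c Q (fpoly J P)
      = diagOp k fun x => MvPolynomial.aeval (fun p => wtY y p x) P := by
  have h : ∀ m : Fin n → ℕ, freeRep y c Q (List.ofFn fun p => fy k J p ^ m p).prod
      = diagOp k fun x => ∏ p, wtY y p x ^ m p := by
    intro m
    rw [map_list_prod, List.map_ofFn]
    have e : (fun x => ∏ p, wtY y p x ^ m p)
        = (List.ofFn fun p => wtY (J := J) y p ^ m p).prod := by
      rw [List.prod_ofFn]
      ext x
      simp
    rw [e, map_list_prod, List.map_ofFn]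
    congr 2
    ext p
    simp only [Function.comp_apply, map_pow, freeRep_y, yOp]
  rw [fpoly, map_sum]
  simp only [map_smul, h]
  simp only [← map_smul, ← map_sum]
  congr 1
  ext x
  rw [MvPolynomial.aeval_def, MvPolynomial.eval₂_eq']
  simp [Algebra.smul_def]

end Representation

/-! ### The representation of `RC_n` and its leading terms. -/

section Representation

variable {k : Type*} [CommRing k] {n : ℕ} {J : Type*} [DecidableEq J]
  {K : Type*} [CommRing K] [Algebra k K] {y : Fin n → K}
  {c : J → J} {Q : J → J → MvPolynomial (Fin 2) k}

theorem aeval_aeval_pair_X (f : Fin n → K) (i j : Fin n) (P : MvPolynomial (Fin 2) k) :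
    MvPolynomial.aeval f
        (MvPolynomial.aeval ![MvPolynomial.X i, (MvPolynomial.X j : MvPolynomial (Fin n) k)] P)
      = MvPolynomial.aeval ![f i, f j] P := by
  rw [MvPolynomial.comp_aeval_apply]
  congr 2
  ext l
  fin_cases l <;> simp

theorem freeRep_braid (hQ : IsDatum c Q) (hy : IsGeneric y) {a b : Fin (n - 1)}
    (hab : (b : ℕ) = a + 1) (ν : Fin n → J) :
    (sigmaOp y c Q b * sigmaOp y c Q a * sigmaOp y c Q b
        - sigmaOp y c Q a * sigmaOp y c Q b * sigmaOp y c Q a) * idemOp k K c ν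
      = (if ν (lo a) = ν (hi b) then
            freeRep y c Q (fpoly J (divDiff (Q (ν (lo a)) (ν (hi a))) (MvPolynomial.X (hi b))
              (MvPolynomial.X (lo a)) (MvPolynomial.X (hi a)))) * idemOp k K c ν
          else 0)
        + (if ν (lo a) = c (ν (hi b)) then
            freeRep y c Q (fpoly J (divDiff (Q (ν (lo a)) (ν (hi a))) (MvPolynomial.X (hi b))
              (-MvPolynomial.X (lo a)) (MvPolynomial.X (hi a))))
              * (cliffOp K (lo a) * cliffOp K (hi b)) * idemOp k K c ν
          else 0) := by
  have hc := hQ.involutive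
  have h0 : lo b = hi a := (RC.hi_eq_lo hab).symm
  have hne : lo a ≠ hi b := by simp [lo, hi, Fin.ext_iff]; omega
  have hne' : hi a ≠ hi b := h0 ▸ lo_ne_hi b
  have e1 : diagOp k ((coefQ y c Q (lo b) (hi b) - coefQ y c Q (lo a) (hi a))
        * coefA y c (lo a) (hi b)) * idemOp k K c ν
      = diagOp k (fun x => if ν (lo a) = ν (hi b) then MvPolynomial.aeval (fun p => wtY y p x)
          (divDiff (Q (ν (lo a)) (ν (hi a))) (MvPolynomial.X (hi b) : MvPolynomial (Fin n) k)
            (MvPolynomial.X (lo a)) (MvPolynomial.X (hi a))) else 0) * idemOp k K c ν := by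
    refine diagOp_mul_idemOp fun x hx => ?_
    subst hx
    simp only [Pi.mul_apply, Pi.sub_apply, coefA, coefQ, mul_ite, mul_zero, h0]
    split_ifs with h
    · rw [map_divDiff, MvPolynomial.aeval_X, MvPolynomial.aeval_X, MvPolynomial.aeval_X,
        divDiff_eq_mul_inverse _ _ _ _ _ (hy.isUnit_wtY hne x).1 rfl, ← h,
        hQ.aeval_symm]
    · rfl
  -- The Clifford product flips both outer slots, so `x` has the colours `c (ν (lo a))` and `c (ν
  -- (hi b))` there. Undoing `c` in the first argument of `Q` produces the argument `-y_a`.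
  have e2 : diagOp k ((coefQ y c Q (lo b) (hi b) - coefQ y c Q (lo a) (hi a))
        * coefB y c (lo a) (hi b)) * (cliffOp K (lo a) * cliffOp K (hi b) * idemOp k K c ν)
      = diagOp k (fun x => if ν (lo a) = c (ν (hi b)) then
          MvPolynomial.aeval (fun p => wtY y p x)
          (divDiff (Q (ν (lo a)) (ν (hi a))) (MvPolynomial.X (hi b) : MvPolynomial (Fin n) k)
            (-MvPolynomial.X (lo a)) (MvPolynomial.X (hi a))) else 0)
          * (cliffOp K (lo a) * cliffOp K (hi b) * idemOp k K c ν) := by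
    refine diagOp_mul_cliffOp_mul_idemOp fun x hx => ?_
    obtain ⟨h1, h2, h3⟩ := colour_opposite_iff hc hne hx
    replace h3 := h3 (hi a) (lo_ne_hi a).symm hne'
    simp only [Pi.mul_apply, Pi.sub_apply, coefB, coefQ, mul_ite, mul_zero, h0, h1, h2, h3,
      hc.injective.eq_iff]
    split_ifs with h
    · rw [map_divDiff, map_neg, MvPolynomial.aeval_X, MvPolynomial.aeval_X,
        MvPolynomial.aeval_X,
        divDiff_eq_mul_inverse _ _ _ _ _ (hy.isUnit_wtY hne x).2 (by ring), ← h,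
        hQ.aeval_symm, ← hQ.aeval_neg_left (ν (lo a)) (ν (hi a)) (-wtY y (lo a) x), neg_neg]
    · rfl
  rw [sigmaOp_braid y hQ hy hab, rOp, ← map_sub, mul_add, ← mul_assoc, ← map_mul, ← map_mul,
    add_mul, mul_assoc (diagOp k (_ * coefB _ _ _ _)), e1, e2]
  congr 1
  · split_ifs
    · rw [freeRep_fpoly]
    · exact (congrArg (· * idemOp k K c ν) (map_zero (diagOp k))).trans (zero_mul _)
  · split_ifs
    · rw [freeRep_fpoly]
      simp only [mul_assoc]
    · exact (congrArg (· * _) (map_zero (diagOp k))).trans (zero_mul _)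

variable [Fintype J]

theorem freeRep_rel (hQ : IsDatum c Q) (hy : IsGeneric y) ⦃x z : FreeAlgebra k (Gen n J)⦄
    (h : Rel c Q x z) : freeRep y c Q x = freeRep y c Q z := by
  have hc := hQ.involutive
  cases h with
  | e_mul_e μ ν =>
    simp only [map_mul, map_zero, apply_ite (freeRep y c Q), freeRep_e, idemOp_mul_idemOp]
  | one => simp only [map_one, map_sum, freeRep_e, sum_idemOp]
  | y_mul_e p ν =>
    simp only [map_mul, freeRep_e, freeRep_y]
    exact diagOp_commute _ _
  | c_mul_e p ν =>
    simp only [map_mul, freeRep_e, freeRep_c, cliffOp_mul_idemOp hc]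
  | y_mul_y p q =>
    simp only [map_mul, freeRep_y]
    exact diagOp_commute _ _
  | c_mul_c p q =>
    simp only [map_mul, map_add, freeRep_c, apply_ite (freeRep y c Q), map_ofNat, map_zero]
    split_ifs with h
    · subst h
      rw [cliffOp_mul_self, one_add_one_eq_two]
    · rw [cliffOp_mul_cliffOp K h, neg_add_cancel]
  | c_mul_y p q =>
    simp only [map_mul, freeRep_c, freeRep_y, apply_ite (freeRep y c Q), map_neg, map_one,
      cliffOp_mul_yOp]
  | s_mul_e a ν =>
    simp only [map_mul, freeRep_e, freeRep_s, sigmaOp_mul_idemOp y hc]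
  | s_mul_c a p =>
    simp only [map_mul, freeRep_c, freeRep_s, sigmaOp_mul_cliffOp y hQ]
  | s_mul_y a p ν h h' =>
    simp only [map_mul, freeRep_s, freeRep_y, sigmaOp_mul_yOp y a h h']
  | s_mul_y_hi a ν =>
    simp only [map_mul, map_sub, map_zero, freeRep_s, freeRep_y, freeRep_c, freeRep_e,
      apply_ite (freeRep y c Q), sigmaOp_mul_yOp_hi_sub y hy]
    rw [sub_mul, diagOp_same_mul_idemOp, mul_assoc, diagOp_opposite_mul_idemOp hc (lo_ne_hi a)]
  | y_hi_mul_s a ν =>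
    simp only [map_mul, map_sub, map_add, map_zero, freeRep_s, freeRep_y, freeRep_c, freeRep_e,
      apply_ite (freeRep y c Q), yOp_hi_mul_sigmaOp_sub y hy]
    rw [add_mul, diagOp_same_mul_idemOp, mul_assoc, diagOp_opposite_mul_idemOp hc (lo_ne_hi a)]
  | s_mul_s a ν =>
    simp only [map_mul, freeRep_s, freeRep_e, freeRep_fpoly, sigmaOp_mul_self y hQ]
    refine diagOp_mul_idemOp fun x hx => ?_
    subst hx
    rw [aeval_aeval_pair_X, coefQ]
  | s_comm a b h => simp only [map_mul, freeRep_s, sigmaOp_comm y hQ h]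
  | braid a b h ν =>
    simp only [map_mul, map_sub, map_add, map_zero, freeRep_s, freeRep_e, freeRep_c,
      apply_ite (freeRep y c Q)]
    exact freeRep_braid hQ hy h ν

/-- The principal series representation. -/
noncomputable def rep (hQ : IsDatum c Q) (hy : IsGeneric y) :
    RC n c Q →ₐ[k] WtEnd n J K :=
  RingQuot.liftAlgHom k ⟨freeRep y c Q, fun _ _ h => freeRep_rel hQ hy h⟩

theorem rep_mk (hQ : IsDatum c Q) (hy : IsGeneric y) (x : FreeAlgebra k (Gen n J)) :
    rep hQ hy (RC.mk c Q x) = freeRep y c Q x :=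
  RingQuot.liftAlgHom_mkAlgHom_apply _ _ _ _

theorem rep_genY (hQ : IsDatum c Q) (hy : IsGeneric y) (p : Fin n) :
    rep hQ hy (RC.genY c Q p) = yOp y k J p := (rep_mk hQ hy _).trans (freeRep_y y c Q p)

theorem rep_genC (hQ : IsDatum c Q) (hy : IsGeneric y) (p : Fin n) :
    rep hQ hy (RC.genC c Q p) = cliffOp K p := (rep_mk hQ hy _).trans (freeRep_c y c Q p)

theorem rep_genS (hQ : IsDatum c Q) (hy : IsGeneric y) (a : Fin (n - 1)) :
    rep hQ hy (RC.genS c Q a) = sigmaOp y c Q a := (rep_mk hQ hy _).trans (freeRep_s y c Q a)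

theorem rep_genE (hQ : IsDatum c Q) (hy : IsGeneric y) (ν : Fin n → J) :
    rep hQ hy (RC.genE c Q ν) = idemOp k K c ν := (rep_mk hQ hy _).trans (freeRep_e y c Q ν)

theorem rep_yPow_app (hQ : IsDatum c Q) (hy : IsGeneric y) (a : Fin n → ℕ)
    (f : WtIndex n J → K) (x : WtIndex n J) :
    (rep hQ hy (RC.yPow c Q a)).app f x = (∏ p, wtY y p x ^ a p) * f x := by
  have h : rep hQ hy (RC.yPow c Q a)
      = diagOp k (List.ofFn fun p => wtY (J := J) y p ^ a p).prod := by
    rw [RC.yPow, map_list_prod, map_list_prod, List.map_ofFn, List.map_ofFn]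
    congr 2
    ext p
    simp only [Function.comp_apply, map_pow, rep_genY, yOp]
  rw [h, diagOp_apply, List.prod_ofFn]
  simp

/-- An arbitrary list makes the induction possible. About the sign it is enough to know that it is
invertible and does not depend on `f`. -/
theorem exists_rep_genC_list_app (hQ : IsDatum c Q) (hy : IsGeneric y) (η : Fin n → ZMod 2)
    (l : List (Fin n)) (x : WtIndex n J) :
    ∃ ε : K, ε * ε = 1 ∧ ∀ f : WtIndex n J → K,
      (rep hQ hy (l.map fun p => RC.genC c Q p ^ (η p).val).prod).app f x
        = ε * f (x.1, x.2.1 + (l.map fun p => Pi.single (x.1⁻¹ p) (η p)).sum, x.2.2) := by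
  induction l generalizing x with
  | nil => exact ⟨1, by simp, fun f => by simp⟩
  | cons p l ih =>
    rcases (by decide : ∀ i : ZMod 2, i = 0 ∨ i = 1) (η p) with h | h
    · obtain ⟨ε, hε, hf⟩ := ih x
      exact ⟨ε, hε, fun f => by simp [h, hf]⟩
    · obtain ⟨ε, hε, hf⟩ := ih (flipAt p x)
      refine ⟨jwSign K p x * ε, ?_, fun f => ?_⟩
      · linear_combination jwSign K p x * jwSign K p x * hε + jwSign_mul_self K p x
      · simp only [List.map_cons, List.prod_cons, h, ZMod.val_one, pow_one, map_mul, rep_genC,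
          WtEnd.app_mul, cliffOp_apply, hf, List.sum_cons, mul_assoc]
        simp only [flipAt, add_assoc]

theorem exists_rep_cPow_app (hQ : IsDatum c Q) (hy : IsGeneric y) (η : Fin n → ZMod 2)
    (x : WtIndex n J) :
    ∃ ε : K, ε * ε = 1 ∧ ∀ f : WtIndex n J → K,
      (rep hQ hy (RC.cPow c Q η)).app f x = ε * f (x.1, x.2.1 + η ∘ x.1, x.2.2) := by
  obtain ⟨ε, hε, hf⟩ := exists_rep_genC_list_app hQ hy η (List.finRange n) x
  refine ⟨ε, hε, fun f => ?_⟩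
  have hs : ((List.finRange n).map fun p => Pi.single (x.1⁻¹ p) (η p)).sum = η ∘ x.1 := by
    rw [← Fin.sum_univ_def]
    ext i
    rw [Finset.sum_apply, Finset.sum_eq_single (x.1 i)]
    · simp
    · intro p _ hp
      refine Pi.single_eq_of_ne (fun h => hp ?_) _
      simp [h]
    · simp
  rw [RC.cPow, List.ofFn_eq_map, hf, hs]

/-- The generating vector of the principal series representation. -/
def deltaFun (K : Type*) [CommRing K] (w : Equiv.Perm (Fin n)) (μ : Fin n → J) :
    WtIndex n J → K := fun x => if x = (w, 0, μ) then 1 else 0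

theorem rep_genE_app_deltaFun (hQ : IsDatum c Q) (hy : IsGeneric y) (μ ν : Fin n → J) :
    (rep hQ hy (RC.genE c Q ν)).app (deltaFun K 1 μ)
      = if ν = μ then deltaFun K 1 μ else 0 := by
  ext x
  rw [rep_genE, idemOp, diagOp_apply, deltaFun]
  by_cases hx : x = (1, 0, μ)
  · have hcol : colour c x = μ := by
      ext p
      simp [hx, colour]
    simp only [hcol, eq_comm (a := μ)]
    split_ifs <;> simp [deltaFun, hx]
  · split_ifs <;> simp [deltaFun, hx]

/-- The leading term of a product of the `σ_a`. -/
theorem rep_sWord_app_deltaFun (hQ : IsDatum c Q) (hy : IsGeneric y) (μ : Fin n → J)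
    (l : List (Fin (n - 1))) (x : WtIndex n J) (hx : l.length ≤ invCount x.1) :
    (rep hQ hy (RC.sWord c Q l)).app (deltaFun K 1 μ) x = deltaFun K (wordProd l) μ x := by
  induction l generalizing x with
  | nil => simp
  | cons a r ih =>
    rw [List.length_cons] at hx
    have hr := invCount_wordProd_le r
    have hzero : ∀ z : WtIndex n J, z.1 = x.1 →
        (rep hQ hy (RC.sWord c Q r)).app (deltaFun K 1 μ) z = 0 := by
      intro z hz
      rw [ih z (by rw [hz]; omega), deltaFun, if_neg]
      rintro rfl
      rw [← hz] at hx
      exact absurd hr (by dsimp only at hx; omega)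
    have hle := le_invCount_mul a x.1
    have hfl : ∀ p q : Fin n, (flipAt q (flipAt p x)).1 = x.1 := fun _ _ => rfl
    rw [RC.sWord_cons, map_mul, rep_genS, sigmaOp, rOp, WtEnd.app_mul]
    simp only [WtEnd.app_add, WtEnd.app_mul, diagOp_apply, cliffOp_apply, twistOp_apply]
    -- `rOp` leaves the permutation unchanged, and the shorter word gives `0` at permutations with
    -- more inversions than its length; only the intertwiner survives.
    rw [hzero x rfl, hzero _ (hfl _ _), ih (reflAt a x) (by simp only [reflAt]; omega)]
    simp only [mul_zero, zero_add, deltaFun, wordProd_cons]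
    have hiff : reflAt a x = (wordProd r, 0, μ) ↔ x = (simpleTransp a * wordProd r, 0, μ) := by
      constructor
      · intro h
        rw [← reflAt_reflAt a x, h, reflAt]
      · rintro rfl
        simp [reflAt]
    simp only [hiff]
    split_ifs with h
    · have h1 : x.1 = simpleTransp a * wordProd r := by rw [h]
      -- The length has gone up, and on that side `coefK` equals `1`.
      have hd : x.1⁻¹ (hi a) < x.1⁻¹ (lo a) := by
        refine inv_hi_lt_of_invCount_lt a ?_
        rw [h1, simpleTransp_mul_self_mul, ← h1]
        omega
      rw [coefK, if_neg hd.not_gt, mul_one]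
    · rw [mul_zero]

end Representation

/-! ### Generic eigenvalues and linear independence. -/

section Independence

variable {k : Type*} [CommRing k] {n : ℕ} {J : Type*}
  {K : Type*} [CommRing K] [Algebra k K] {y : Fin n → K}

theorem algebraMap_signOf (i : ZMod 2) : algebraMap k K (signOf k i) = signOf K i := by
  unfold signOf
  split_ifs <;> simp

/-- The eigenvalues are the `y_i`, permuted and multiplied by signs, and the sign change `g` of the
variables is its own inverse. -/
theorem algebraicIndependent_wtY (hy : AlgebraicIndependent k y) (x : WtIndex n J) :
    AlgebraicIndependent k fun p => wtY y p x := by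
  set ε : Fin n → k := fun p => signOf k (x.2.1 (x.1⁻¹ p)) with hε
  set g : Fin n → MvPolynomial (Fin n) k := fun p => MvPolynomial.C (ε p) * MvPolynomial.X p
    with hg
  have hg2 : ∀ P, MvPolynomial.aeval g (MvPolynomial.aeval g P) = P := by
    intro P
    rw [MvPolynomial.comp_aeval_apply]
    have : (fun p => MvPolynomial.aeval g (g p)) = MvPolynomial.X := by
      ext1 p
      simp only [hg, map_mul, MvPolynomial.aeval_X, MvPolynomial.algHom_C]
      rw [← mul_assoc, MvPolynomial.algebraMap_eq, ← MvPolynomial.C_mul, hε, signOf_mul_self,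
        MvPolynomial.C_1, one_mul]
    rw [this, MvPolynomial.aeval_X_left_apply]
  have hy' : AlgebraicIndependent k fun p => y (x.1⁻¹ p) :=
    hy.comp _ x.1⁻¹.injective
  rw [algebraicIndependent_iff] at hy' ⊢
  intro P hP
  have h : MvPolynomial.aeval (fun p => y (x.1⁻¹ p)) (MvPolynomial.aeval g P) = 0 := by
    rw [MvPolynomial.comp_aeval_apply, ← hP]
    congr 2
    ext p
    simp only [hg, map_mul, MvPolynomial.aeval_X, MvPolynomial.algHom_C, hε, algebraMap_signOf,
      wtY]
  rw [← hg2 P, hy' _ h, map_zero]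

/-- The substitution `f` turns `X_i - s X_j` into `X_i`, a nonzerodivisor over every commutative
ring, and is injective because `g` is a left inverse. Thus `k` need not be a domain. -/
theorem isGeneric_fractionRing (k : Type*) [CommRing k] (n : ℕ) :
    IsGeneric fun p : Fin n =>
      algebraMap (MvPolynomial (Fin n) k) (FractionRing (MvPolynomial (Fin n) k))
        (MvPolynomial.X p) := by
  have key : ∀ (i j : Fin n) (r : MvPolynomial (Fin n) k),
      (∃ s : k, r = MvPolynomial.C s * MvPolynomial.X j) → i ≠ j →
      MvPolynomial.X i - r ∈ nonZeroDivisors (MvPolynomial (Fin n) k) := by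
    rintro i j r ⟨s, rfl⟩ hij
    set f : MvPolynomial (Fin n) k →ₐ[k] MvPolynomial (Fin n) k := MvPolynomial.aeval
      (Function.update MvPolynomial.X i
        (MvPolynomial.X i + MvPolynomial.C s * MvPolynomial.X j)) with hf
    set g : MvPolynomial (Fin n) k →ₐ[k] MvPolynomial (Fin n) k := MvPolynomial.aeval
      (Function.update MvPolynomial.X i
        (MvPolynomial.X i - MvPolynomial.C s * MvPolynomial.X j)) with hg
    have hgf : g.comp f = AlgHom.id k _ := by
      refine MvPolynomial.algHom_ext fun p => ?_
      by_cases hp : p = i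
      · subst hp
        simp [hf, hg, Function.update_of_ne hij.symm, ← MvPolynomial.algebraMap_eq]
      · simp [hf, hg, Function.update_of_ne hp]
    have hfi : f (MvPolynomial.X i - MvPolynomial.C s * MvPolynomial.X j)
        = MvPolynomial.X i := by
      simp [hf, Function.update_of_ne hij.symm, ← MvPolynomial.algebraMap_eq]
    rw [mem_nonZeroDivisors_iff_right]
    intro z hz
    have h := congrArg f hz
    rw [map_mul, hfi, map_zero] at h
    have hz0 : f z = 0 := MvPolynomial.isRegular_X.right (h.trans (zero_mul _).symm)
    have := DFunLike.congr_fun hgf z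
    simpa [hz0] using this.symm
  intro i j hij
  have h1 := key i j (MvPolynomial.X j) ⟨1, by simp⟩ hij
  have h2 := key i j (-MvPolynomial.X j) ⟨-1, by simp⟩ hij
  rw [sub_neg_eq_add] at h2
  rw [← map_sub, ← map_add]
  exact ⟨IsLocalization.map_units (FractionRing (MvPolynomial (Fin n) k)) ⟨_, h1⟩,
    IsLocalization.map_units (FractionRing (MvPolynomial (Fin n) k)) ⟨_, h2⟩⟩

theorem algebraicIndependent_fractionRing (k : Type*) [CommRing k] (n : ℕ) :
    AlgebraicIndependent k fun p : Fin n =>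
      algebraMap (MvPolynomial (Fin n) k) (FractionRing (MvPolynomial (Fin n) k))
        (MvPolynomial.X p) := by
  rw [algebraicIndependent_iff]
  intro P hP
  have h := MvPolynomial.comp_aeval_apply (MvPolynomial.X : Fin n → MvPolynomial (Fin n) k)
    (IsScalarTower.toAlgHom k (MvPolynomial (Fin n) k) (FractionRing (MvPolynomial (Fin n) k))) P
  rw [MvPolynomial.aeval_X_left_apply] at h
  refine IsFractionRing.injective (MvPolynomial (Fin n) k)
    (FractionRing (MvPolynomial (Fin n) k)) ?_
  rw [map_zero]
  exact h.trans hP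

variable [Fintype J] [DecidableEq J] {c : J → J} {Q : J → J → MvPolynomial (Fin 2) k}

theorem linearIndependent_of_rep (hQ : IsDatum c Q) (hy : IsGeneric y)
    (hy' : AlgebraicIndependent k y)
    (word : Equiv.Perm (Fin n) → List (Fin (n - 1))) (hword : ∀ w, IsReducedExpr w (word w)) :
    LinearIndependent k
      fun t : (Fin n → ℕ) × (Fin n → ZMod 2) × Equiv.Perm (Fin n) × (Fin n → J) =>
        RC.yPow c Q t.1 * RC.cPow c Q t.2.1 * RC.sWord c Q (word t.2.2.1)
          * RC.genE c Q t.2.2.2 := by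
  classical
  rw [linearIndependent_iff']
  intro s g hg t₁ ht₁
  by_contra hne
  -- Maximality of `w` ensures that the leading term formula applies to every term with nonzero
  -- coefficient.
  obtain ⟨⟨a, η, w, ν⟩, ht, hmax⟩ := Finset.exists_max_image (s.filter fun t => g t ≠ 0)
    (fun t => invCount t.2.2.1) ⟨t₁, Finset.mem_filter.2 ⟨ht₁, hne⟩⟩
  rw [Finset.mem_filter] at ht
  -- `c^η` shifts the signs at `w` by `η ∘ w`, so this is the point where it reads off the delta
  -- function at `(w, 0, ν)`.
  set x : WtIndex n J := (w, η ∘ w, ν) with hx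
  obtain ⟨ε, hε, hεf⟩ := exists_rep_cPow_app (k := k) hQ hy η x
  have hval : ∀ t ∈ s, (rep hQ hy (g t • (RC.yPow c Q t.1 * RC.cPow c Q t.2.1
        * RC.sWord c Q (word t.2.2.1) * RC.genE c Q t.2.2.2))).app (deltaFun K 1 ν) x
      = ε * MvPolynomial.aeval (fun p => wtY y p x)
          (if t.2 = (η, w, ν) then
            MvPolynomial.monomial (Finsupp.equivFunOnFinite.symm t.1) (g t) else 0) := by
    rintro ⟨b, ζ, v, μ⟩ hts
    by_cases hgt : g (b, ζ, v, μ) = 0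
    · simp only [hgt, zero_smul, map_zero, ite_self, mul_zero]
      rfl
    have hlen : invCount v ≤ invCount w := hmax _ (Finset.mem_filter.2 ⟨hts, hgt⟩)
    dsimp only
    rw [map_smul, WtEnd.app_smul, map_mul, map_mul, map_mul, WtEnd.app_mul, WtEnd.app_mul,
      WtEnd.app_mul, rep_genE_app_deltaFun, rep_yPow_app]
    obtain ⟨δ, hδ, hδf⟩ := exists_rep_cPow_app (k := k) hQ hy ζ x
    rw [hδf]
    by_cases hμ : μ = ν
    · rw [if_pos hμ, rep_sWord_app_deltaFun hQ hy ν _ _ (by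
        rw [(hword v).length_eq]; exact hlen), (hword v).1, deltaFun]
      by_cases hv : w = v
      · subst hv
        by_cases hζ : ζ = η
        · subst hζ
          -- Both signs describe the same operator at the same point; the constant function `1`
          -- reveals them.
          have hεδ : ε = δ := by
            have h1 := hεf (fun _ => 1)
            have h2 := hδf (fun _ => 1)
            rw [mul_one] at h1 h2
            rw [← h1, ← h2]
          have h0 : ζ ∘ w + ζ ∘ w = 0 := by
            ext i
            exact (by decide : ∀ i : ZMod 2, i + i = 0) (ζ (w i))
          subst hμ
          rw [if_pos (by rw [hx]; simp only [h0]), if_pos rfl, MvPolynomial.aeval_monomial,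
            Finsupp.prod_fintype _ _ (fun _ => pow_zero _), Algebra.smul_def, hεδ]
          simp only [Finsupp.equivFunOnFinite_symm_apply_apply]
          ring
        · rw [if_neg, if_neg (fun h => hζ (congrArg (fun t => t.1) h))]
          · simp
          · intro h
            apply hζ
            have h1 : η ∘ w + ζ ∘ w = 0 := congrArg (fun t => t.2.1) h
            ext i
            have h2 := congrFun h1 (w⁻¹ i)
            have h3 : η i + ζ i = 0 := by simpa using h2
            rw [(by decide : ∀ i j : ZMod 2, i + j = 0 → j = i) _ _ h3]
      · rw [if_neg (fun h => hv (congrArg (fun t => t.1) h)),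
          if_neg (fun h => hv (congrArg (fun t => t.2.1) h).symm)]
        simp
    · rw [if_neg hμ, if_neg (fun h => hμ (congrArg (fun t => t.2.2) h))]
      simp
  have hsum : (0 : K) = ε * MvPolynomial.aeval (fun p => wtY y p x)
      (∑ t ∈ s, if t.2 = (η, w, ν) then
        MvPolynomial.monomial (Finsupp.equivFunOnFinite.symm t.1) (g t) else 0) := by
    rw [map_sum, Finset.mul_sum, ← Finset.sum_congr rfl hval, ← WtEnd.app_sum,
      ← map_sum, hg, map_zero]
    rfl
  have hP : (∑ t ∈ s, if t.2 = (η, w, ν) then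
      MvPolynomial.monomial (Finsupp.equivFunOnFinite.symm t.1) (g t) else 0) = 0 := by
    refine (algebraicIndependent_iff.1 (algebraicIndependent_wtY hy' x)) _ ?_
    have := congrArg (ε * ·) hsum
    simp only [mul_zero, ← mul_assoc, hε, one_mul] at this
    exact this.symm
  apply ht.2
  have hcoef := congrArg (MvPolynomial.coeff (Finsupp.equivFunOnFinite.symm a)) hP
  rw [MvPolynomial.coeff_sum, Finset.sum_eq_single (a, η, w, ν)] at hcoef
  · simpa using hcoef
  · rintro ⟨b, t⟩ _ hbt
    dsimp only
    split_ifs with h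
    · rw [MvPolynomial.coeff_monomial, if_neg]
      intro hab
      exact hbt (by rw [h, Finsupp.equivFunOnFinite.symm.injective hab])
    · rfl
  · exact fun h => absurd ht.1 h

end Independence

end QHC

theorem corollary3p6 {k : Type*} [CommRing k] [Invertible (2 : k)]
    {J : Type*} [Fintype J] [DecidableEq J] (c : J → J) (Q : J → J → MvPolynomial (Fin 2) k)
    (hQ : QHC.IsDatum c Q) (n : ℕ)
    (word : Equiv.Perm (Fin n) → List (Fin (n - 1)))
    (hword : ∀ w, QHC.IsReducedExpr w (word w)) :
    ∃ b : Module.Basis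
        ((Fin n → ℕ) × (Fin n → ZMod 2) × Equiv.Perm (Fin n) × (Fin n → J)) k (QHC.RC n c Q),
      ∀ (a : Fin n → ℕ) (η : Fin n → ZMod 2) (w : Equiv.Perm (Fin n)) (ν : Fin n → J),
        b (a, η, w, ν) =
          QHC.RC.yPow c Q a * QHC.RC.cPow c Q η * QHC.RC.sWord c Q (word w) * QHC.RC.genE c Q ν := by
  refine ⟨Module.Basis.mk
    (QHC.linearIndependent_of_rep hQ (QHC.isGeneric_fractionRing k n)
      (QHC.algebraicIndependent_fractionRing k n) word hword)
    (QHC.RC.span_eq_top c Q hQ.involutive word hword).ge, fun a η w ν => ?_⟩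
  rw [Module.Basis.mk_apply]
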